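/- **Parameter regularity of finite element coefficients.** Let $\Omega_x\subset\mathbb R^d$ ($d\ge 1$) be a bounded open set (for instance a convex polygon or polyhedron, or a bounded $C^{1,1}$ domain), let $\Omega_t=[0,1]^{N_t}$ and let $0<\mu_{\min}\le\mu_{\max}<\infty$. Let $H_0^1(\Omega_x)$ be the closure of $C_c^\infty(\Omega_x)$ in $H^1(\Omega_x)$, $H^{-1}(\Omega_x)$ its dual, and $W=L^2(\Omega_t;H^1_0(\Omega_x))$ with $\|v\|_W=\|\nabla v\|_{L^2(\Omega_x\times\Omega_t)}$ and dual norm $$\|F\|_{W'}=\sup_{0\ne v\in W}\frac{1}{\|v\|_W}\int_{\Omega_t}\langle F(t),v(t)\rangle_{H^{-1}\times H^1_0}\,dt .$$ Let $$\mu(x,t)=\mu_0(x)+\sum_{i=1}^{N_t}t_i\,\mu_i(x),\qquad f(t)=f_0+\sum_{i=1}^{N_t}t_i\,f_i,$$ with $\mu_i\in L^\infty(\Omega_x)$, $f_i\in H^{-1}(\Omega_x)$ for $0\le i\le N_t$, and $\mu_{\min}\le\mu\le\mu_{\max}$ a.e. in $\Omega_x\times\Omega_t$. Let $V_{h_x}\subset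 H^1_0(\Omega_x)$ be a finite element space (any finite-dimensional subspace) with basis $\varphi_1,\dots,\varphi_K$ and mesh size $h_x>0$, and assume that the coefficient extraction map $E\bigl(\sum_j a_j\varphi_j\bigr)=(a_1,\dots,a_K)^\top$ satisfies $$\|E(v)\|_{\ell^2}\le c_E\,h_x^{-d/2}\,\|v\|_{L^2(\Omega_x)}\qquad\forall v\in V_{h_x}$$ (as is the case on shape-regular, quasi-uniform meshes). Then for every $t\in\Omega_t$ there is exactly one $\mathbf u(t)=(u_1(t),\dots,u_K(t))^\top\in\mathbb R^K$ such that $u_{h_x}(\cdot,t)=\sum_j u_j(t)\varphi_j$ satisfies $$(\nabla u_{h_x}(\cdot,t),\nabla v)_{L^2(\Omega_x)}+(\mu(\cdot,t)u_{h_x}(\cdot,t),v)_{L^2(\Omega_x)}=\langle f(t),v\rangle\qquad\forall v\in V_{h_x}.$$ Moreover, for every integer $k\ge1$, if $\mathbf u:\Omega_t\to\mathbb R^K$ satisfies this equation for a.e. $t\in\Omega_t$, then $\mathbf u\in H^k(\Omega_t;\ell^2)$, and its weak derivatives satisfy $$\sum_{|\alpha|\le k}\|\partial_t^\alpha\mathbf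 u\|_{L^2(\Omega_t;\ell^2)}\le C_k\,h_x^{-d/2}\Bigl(\|f\|_{W'}+\sum_{i=1}^{N_t}\|\partial_{t_i}f\|_{W'}\Bigr),$$ where $C_k$ depends only on $k$, $d$, $N_t$, $\Omega_x$, $\mu_{\min}$, $\mu_{\max}$, upper bounds for $\|\mu_i\|_{L^\infty(\Omega_x)}$ ($0\le i\le N_t$), and $c_E$; in particular it is independent of $t$, $f$, $h_x$, $V_{h_x}$ and its basis. In particular each scalar coefficient $u_1,\dots,u_K$ lies in $H^k(\Omega_t)$. -/

import Mathlib

open MeasureTheory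
open scoped ContDiff ENNReal NNReal

noncomputable section

namespace ParamFEM

/-! ### The spatial Sobolev space `H₀¹(Ω)` and its dual -/

/-- The space `ℝᵈ` with its Euclidean norm. -/
abbrev Space (d : ℕ) := EuclideanSpace ℝ (Fin d)

/-- The Hilbert space `L²(Ω) × L²(Ω; ℝᵈ)` of pairs (function, gradient), with the norm
`(‖v‖² + ‖g‖²)^(1/2)`. -/
abbrev GraphSpace {d : ℕ} (Ω : Set (Space d)) :=
  WithLp 2 (Lp ℝ 2 (volume.restrict Ω) × Lp (Space d) 2 (volume.restrict Ω))

/-- The pairs `(φ, ∇φ)` with `φ ∈ C_c^∞(Ω)`. -/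
def testPairs {d : ℕ} (Ω : Set (Space d)) : Set (GraphSpace Ω) :=
  {p | ∃ φ : Space d → ℝ, ContDiff ℝ ∞ φ ∧ HasCompactSupport φ ∧ tsupport φ ⊆ Ω ∧
    p.fst =ᵐ[volume.restrict Ω] φ ∧ p.snd =ᵐ[volume.restrict Ω] gradient φ}

/-- `H₀¹(Ω)`: the closure of `C_c^∞(Ω)` in the `H¹`-norm, an element `v` being stored together with
its weak gradient, which is determined by `v`. -/
def H01 {d : ℕ} (Ω : Set (Space d)) : Submodule ℝ (GraphSpace Ω) :=
  (Submodule.span ℝ (testPairs Ω)).topologicalClosure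

/-- The function `v ∈ L²(Ω)` underlying an element of `H₀¹(Ω)`. -/
def toFun {d : ℕ} {Ω : Set (Space d)} (v : H01 Ω) : Lp ℝ 2 (volume.restrict Ω) :=
  (v : GraphSpace Ω).fst

/-- The weak gradient `∇v ∈ L²(Ω; ℝᵈ)` of an element of `H₀¹(Ω)`. -/
def grad {d : ℕ} {Ω : Set (Space d)} (v : H01 Ω) : Lp (Space d) 2 (volume.restrict Ω) :=
  (v : GraphSpace Ω).snd

/-- `H⁻¹(Ω)`, the space of bounded linear functionals on `H₀¹(Ω)`. -/
abbrev HNegOne {d : ℕ} (Ω : Set (Space d)) := H01 Ω →L[ℝ] ℝ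

/-! ### The parameter domain, `W = L²(Ω_t; H₀¹(Ω))` and the dual norm -/

/-- The space `ℝᴺ` of parameters `t = (t₁, …, t_N)`. -/
abbrev Param (N : ℕ) := Fin N → ℝ

/-- The parameter domain `Ω_t = [0,1]ᴺ`. -/
def paramCube (N : ℕ) : Set (Param N) := Set.Icc 0 1

/-- `W = L²(Ω_t; H₀¹(Ω))`. -/
abbrev WSpace {d : ℕ} (Ω : Set (Space d)) (N : ℕ) :=
  Lp (H01 Ω) 2 (volume.restrict (paramCube N))

/-- `‖v‖_W = ‖∇v‖_{L²(Ω × Ω_t)}`. -/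
def wNorm {d N : ℕ} {Ω : Set (Space d)} (v : WSpace Ω N) : ℝ :=
  Real.sqrt (∫ t in paramCube N, ‖grad (v t)‖ ^ 2)

/-- `⟨F, v⟩_{W' × W} = ∫_{Ω_t} ⟨F(t), v(t)⟩ dt`. -/
def wPairing {d N : ℕ} {Ω : Set (Space d)} (F : Param N → HNegOne Ω) (v : WSpace Ω N) : ℝ :=
  ∫ t in paramCube N, F t (v t)

/-- `‖F‖_{W'} = sup_{0 ≠ v ∈ W} ⟨F, v⟩ / ‖v‖_W`. -/
def wDualNorm {d N : ℕ} {Ω : Set (Space d)} (F : Param N → HNegOne Ω) : ℝ :=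
  ⨆ v : {v : WSpace Ω N // v ≠ 0}, wPairing F v.1 / wNorm v.1

/-! ### Parameter derivatives and `H^k(Ω_t; X)` -/

section Derivatives

variable {N : ℕ} {X : Type*} [NormedAddCommGroup X] [NormedSpace ℝ X]

/-- The classical partial derivative `∂_{t_i} g`. -/
def partialDeriv (i : Fin N) (g : Param N → X) : Param N → X :=
  fun t => fderiv ℝ g t (Pi.single i 1)

/-- The classical derivative `∂_t^α g = ∂_{t_1}^{α_1} ⋯ ∂_{t_N}^{α_N} g`. -/
def multiDeriv (α : Fin N → ℕ) (g : Param N → X) : Param N → X :=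
  (List.finRange N).foldr (fun i G => (partialDeriv i)^[α i] G) g

/-- `w ∈ L²(Ω_t; X)` is the weak derivative `∂_t^α u`, tested against `C_c^∞((0,1)ᴺ)`. -/
def HasWeakDeriv (α : Fin N → ℕ) (u w : Param N → X) : Prop :=
  MemLp w 2 (volume.restrict (paramCube N)) ∧
    ∀ φ : Param N → ℝ, ContDiff ℝ ∞ φ → HasCompactSupport φ →
      tsupport φ ⊆ interior (paramCube N) →
      ∫ t in paramCube N, multiDeriv α φ t • u t =
        (-1 : ℝ) ^ (∑ i, α i) • ∫ t in paramCube N, φ t • w t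

/-- The multi-indices `α ∈ ℕᴺ` with `|α| ≤ k`. -/
def multiIndices (N k : ℕ) : Finset (Fin N → ℕ) :=
  (Fintype.piFinset fun _ : Fin N => Finset.range (k + 1)).filter fun α => ∑ i, α i ≤ k

theorem mem_multiIndices {k : ℕ} {α : Fin N → ℕ} : α ∈ multiIndices N k ↔ ∑ i, α i ≤ k := by
  simp only [multiIndices, Finset.mem_filter, Fintype.mem_piFinset, Finset.mem_range,
    and_iff_right_iff_imp]
  intro h i
  have := Finset.single_le_sum (f := α) (fun _ _ => Nat.zero_le _) (Finset.mem_univ i)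
  omega

/-- `u ∈ H^k(Ω_t; X)`. -/
def MemHk (k : ℕ) (u : Param N → X) : Prop :=
  MemLp u 2 (volume.restrict (paramCube N)) ∧ ∀ α ∈ multiIndices N k, ∃ w, HasWeakDeriv α u w

/-- The norm of `L²(Ω_t; X)`. -/
def l2Norm (w : Param N → X) : ℝ := (eLpNorm w 2 (volume.restrict (paramCube N))).toReal

end Derivatives

/-! ### Affine data and the discrete problem -/

/-- The potential `μ(x,t) = μ₀(x) + ∑ᵢ tᵢ μᵢ(x)`. -/
def potential {d N : ℕ} (μ : Fin (N + 1) → Space d → ℝ) (x : Space d) (t : Param N) : ℝ :=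
  μ 0 x + ∑ i : Fin N, t i * μ i.succ x

/-- The right-hand side `f(t) = f₀ + ∑ᵢ tᵢ fᵢ` with values in `H⁻¹(Ω)`. -/
def source {d N : ℕ} {Ω : Set (Space d)} (f : Fin (N + 1) → HNegOne Ω) (t : Param N) :
    HNegOne Ω :=
  f 0 + ∑ i : Fin N, t i • f i.succ

/-- The Galerkin equation at the parameter `t`: `v_h ∈ V_h` satisfies
`(∇v_h, ∇v)_Ω + (μ(·,t) v_h, v)_Ω = ⟨f(·,t), v⟩` for all `v ∈ V_h`. -/
def IsGalerkinSolution {d N : ℕ} {Ω : Set (Space d)} (μ : Fin (N + 1) → Space d → ℝ)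
    (f : Fin (N + 1) → HNegOne Ω) (V : Submodule ℝ (H01 Ω)) (t : Param N) (vh : V) : Prop :=
  ∀ v : V, inner ℝ (grad vh.1) (grad v.1) + ∫ x in Ω, potential μ x t * toFun vh.1 x * toFun v.1 x =
    source f t v.1

/-- The coefficient extraction map `E (∑ⱼ aⱼ φⱼ) = (a₁, …, a_K)`, with values in `ℓ²`. -/
def coeffs {d K : ℕ} {Ω : Set (Space d)} {V : Submodule ℝ (H01 Ω)}
    (φ : Module.Basis (Fin K) ℝ V) (v : V) : EuclideanSpace ℝ (Fin K) :=
  WithLp.toLp 2 (φ.equivFun v)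

end ParamFEM

end

open MeasureTheory
open scoped ContDiff ENNReal NNReal

noncomputable section

namespace ParamFEM

/-! ### The Poincaré inequality -/

/-! In coordinates the Galerkin equation is a finite linear system B(t) x(t) = F(t) with B and F
affine in t. On the cube the potential is nonnegative, so the form dominates ‖∇v‖². By the Poincaré
inequality B(t) is then injective, hence invertible. Invertibility is an open condition and
inversion is smooth, so after a cutoff the solution is the restriction of a globally smooth x that
solves the system on an open neighbourhood of the cube (`exists_contDiff_solution`). Any a.e.
solution u equals x a.e., and its weak derivatives are the classical derivatives of x.

For the estimate, differentiate B(t) x(t) = F(t) along a word L of parameter directions. Since B is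
affine, the Leibniz rule leaves B(t) ∂_L x = ∂_L F − ∑_j B_j ∂_{L without letter j} x
(`affine_apply_wordDeriv`). Testing with ∂_L x, integrating over the cube and using coercivity, the
dual norm, Cauchy–Schwarz and Poincaré bounds the energy norm of ∂_L x by the data plus energy norms
of derivatives one order lower (`energyNorm_wordDeriv_le_sum`); induction on the order closes the
argument. Poincaré and the inverse bound on E then turn energy norms into ℓ² norms of coefficients.
No constant sees the discrete space, because every estimate is one in `H01 Ω`.

Words replace multi-indices so that the Leibniz rule has no multiplicities and partial derivatives
never need to be commuted. -/

theorem norm_sq_eq_integral {α E : Type*} [MeasurableSpace α] {ν : Measure α}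
    [NormedAddCommGroup E] [InnerProductSpace ℝ E] (f : Lp E 2 ν) :
    ‖f‖ ^ 2 = ∫ x, ‖f x‖ ^ 2 ∂ν := by
  rw [← real_inner_self_eq_norm_sq, L2.inner_def]
  simp only [real_inner_self_eq_norm_sq]

/-- Integrate φ² · 1 by parts in the direction e, with 1 written as the derivative of the linear
function g along e. -/
theorem integral_sq_eq_of_hasCompactSupport {d : ℕ} {φ : Space d → ℝ} (hφ : ContDiff ℝ ∞ φ)
    (hc : HasCompactSupport φ) (g : Space d →L[ℝ] ℝ) {e : Space d} (he : g e = 1) :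
    ∫ x, φ x ^ 2 = ∫ x, -(2 * φ x * fderiv ℝ φ x e * g x) := by
  have hφD : Differentiable ℝ φ := hφ.differentiable (by simp)
  have hsqd : ∀ x, fderiv ℝ (fun y => φ y ^ 2) x e = 2 * φ x * fderiv ℝ φ x e := fun x => by
    rw [fderiv_fun_pow _ (hφD x)]; simp
  have hφc : Continuous φ := hφ.continuous
  have hfc : Continuous fun x => fderiv ℝ φ x e :=
    (hφ.continuous_fderiv (by simp)).clm_apply continuous_const
  have hsq : HasCompactSupport fun x => φ x ^ 2 := hc.comp_left (g := fun y => y ^ 2) (by simp)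
  have h1 : Integrable (fun x => φ x ^ 2) := (hφc.pow 2).integrable_of_hasCompactSupport hsq
  have h2 : Integrable (fun x => 2 * φ x * fderiv ℝ φ x e * g x) := by
    have hs : HasCompactSupport fun x => φ x * (2 * fderiv ℝ φ x e * g x) := hc.mul_right
    have heq : (fun x => 2 * φ x * fderiv ℝ φ x e * g x) =
        fun x => φ x * (2 * fderiv ℝ φ x e * g x) := by
      funext x; ring
    rw [heq]
    exact Continuous.integrable_of_hasCompactSupport (by fun_prop) hs
  have h3 : Integrable (fun x => φ x ^ 2 * g x) :=
    Continuous.integrable_of_hasCompactSupport (by fun_prop) hsq.mul_right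
  have key := integral_mul_fderiv_eq_neg_fderiv_mul_of_integrable (μ := (volume : Measure (Space d)))
    (f := fun x => φ x ^ 2) (g := g) (v := e)
    (by simpa only [hsqd] using h2) (by simpa [he] using h1) h3
    (fun x _ => (hφD x).pow 2) (fun x _ => g.differentiableAt)
  simpa only [hsqd, ContinuousLinearMap.fderiv, he, mul_one, ← integral_neg] using key

theorem norm_gradient {d : ℕ} (φ : Space d → ℝ) (x : Space d) :
    ‖gradient φ x‖ = ‖fderiv ℝ φ x‖ := by
  simp [gradient]

theorem integrable_sq_norm_fderiv {d : ℕ} {φ : Space d → ℝ} (hφ : ContDiff ℝ ∞ φ)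
    (hc : HasCompactSupport φ) : Integrable fun x => ‖fderiv ℝ φ x‖ ^ 2 := by
  have hdc : Continuous (fderiv ℝ φ) := hφ.continuous_fderiv (by simp)
  have hcont : Continuous fun x => ‖fderiv ℝ φ x‖ ^ 2 := hdc.norm.pow 2
  have hs : HasCompactSupport fun x => ‖fderiv ℝ φ x‖ ^ 2 := by
    refine hc.mono' fun x hx => ?_
    by_contra h
    exact hx (by simp [image_eq_zero_of_notMem_tsupport fun h' => h (tsupport_fderiv_subset ℝ h')])
  exact hcont.integrable_of_hasCompactSupport hs

/-- Young's inequality −2φ(g ∂φ) ≤ φ²/2 + 2(g ∂φ)² with |g| ≤ R on the support lets half of ∫ φ² be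
absorbed on the left; this produces 4R² = (2R)². -/
theorem integral_sq_le_of_hasCompactSupport {d : ℕ} {φ : Space d → ℝ}
    (hφ : ContDiff ℝ ∞ φ) (hc : HasCompactSupport φ) (g : Space d →L[ℝ] ℝ) {e : Space d}
    (hge : g e = 1) (hen : ‖e‖ = 1) (hgx : ∀ x, |g x| ≤ ‖x‖) {R : ℝ}
    (hR : ∀ x ∈ tsupport φ, ‖x‖ ≤ R) :
    ∫ x, φ x ^ 2 ≤ (2 * R) ^ 2 * ∫ x, ‖gradient φ x‖ ^ 2 := by
  have key := integral_sq_eq_of_hasCompactSupport hφ hc g hge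
  have hφc : Continuous φ := hφ.continuous
  have hsq : HasCompactSupport fun x => φ x ^ 2 := hc.comp_left (g := fun y => y ^ 2) (by simp)
  have h1 : Integrable (fun x => φ x ^ 2) := (hφc.pow 2).integrable_of_hasCompactSupport hsq
  have h4 := integrable_sq_norm_fderiv hφ hc
  simp only [norm_gradient]
  have hle : ∫ x, -(2 * φ x * fderiv ℝ φ x e * g x) ≤
      ∫ x, (1 / 2 * φ x ^ 2 + 2 * R ^ 2 * ‖fderiv ℝ φ x‖ ^ 2) := by
    have hrhs : Integrable fun x => 1 / 2 * φ x ^ 2 + 2 * R ^ 2 * ‖fderiv ℝ φ x‖ ^ 2 :=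
      (h1.const_mul _).add (h4.const_mul _)
    -- Without integrability the left integral is 0 by convention, and the right side is
    -- nonnegative.
    by_cases hlhs : Integrable fun x => -(2 * φ x * fderiv ℝ φ x e * g x)
    · refine integral_mono hlhs hrhs fun x => ?_
      by_cases hx : x ∈ tsupport φ
      · have hxR : |g x| ≤ R := (hgx x).trans (hR x hx)
        have hdx : |fderiv ℝ φ x e| ≤ ‖fderiv ℝ φ x‖ := by
          simpa [hen] using (fderiv ℝ φ x).le_opNorm e
        have hmul : |g x * fderiv ℝ φ x e| ≤ R * ‖fderiv ℝ φ x‖ := by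
          rw [abs_mul]; exact mul_le_mul hxR hdx (abs_nonneg _) ((abs_nonneg _).trans hxR)
        have hsq : (g x * fderiv ℝ φ x e) ^ 2 ≤ (R * ‖fderiv ℝ φ x‖) ^ 2 :=
          sq_le_sq' (abs_le.1 hmul).1 (abs_le.1 hmul).2
        dsimp only
        nlinarith [sq_nonneg (φ x + 2 * (g x * fderiv ℝ φ x e))]
      · have h0 : φ x = 0 := image_eq_zero_of_notMem_tsupport hx
        have : 0 ≤ 2 * R ^ 2 * ‖fderiv ℝ φ x‖ ^ 2 := by positivity
        simpa [h0] using this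
    · rw [integral_undef hlhs]
      exact integral_nonneg fun x => by positivity
  rw [← key, integral_add (h1.const_mul _) (h4.const_mul _), integral_const_mul,
    integral_const_mul] at hle
  linarith

theorem norm_fst_le_of_mem_testPairs {d : ℕ} (hd : 0 < d) {Ω : Set (Space d)} {R : ℝ}
    (hR0 : 0 ≤ R) (hR : ∀ x ∈ Ω, ‖x‖ ≤ R) {p : GraphSpace Ω} (hp : p ∈ testPairs Ω) :
    ‖p.fst‖ ≤ 2 * R * ‖p.snd‖ := by
  obtain ⟨φ, hφ, hc, hs, h1, h2⟩ := hp
  refine (pow_le_pow_iff_left₀ (norm_nonneg _) (by positivity) two_ne_zero).1 ?_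
  rw [mul_pow, norm_sq_eq_integral, norm_sq_eq_integral]
  have e1 : ∫ x in Ω, ‖p.fst x‖ ^ 2 = ∫ x, φ x ^ 2 := by
    rw [← setIntegral_eq_integral_of_forall_compl_eq_zero (s := Ω) (μ := volume)
      (f := fun x => φ x ^ 2)]
    · exact integral_congr_ae (h1.mono fun x hx => by simp only [hx, Real.norm_eq_abs, sq_abs])
    · intro x hx
      simp [image_eq_zero_of_notMem_tsupport fun h => hx (hs h)]
  have e2 : ∫ x in Ω, ‖p.snd x‖ ^ 2 = ∫ x, ‖gradient φ x‖ ^ 2 := by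
    rw [← setIntegral_eq_integral_of_forall_compl_eq_zero (s := Ω) (μ := volume)
      (f := fun x => ‖gradient φ x‖ ^ 2)]
    · exact integral_congr_ae (h2.mono fun x hx => by simp only [hx])
    · intro x hx
      have : fderiv ℝ φ x = 0 := image_eq_zero_of_notMem_tsupport
        fun h => hx (hs (tsupport_fderiv_subset ℝ h))
      simp [gradient, this]
  rw [e1, e2]
  -- The linear function is the first coordinate, which exists because d ≥ 1.
  exact integral_sq_le_of_hasCompactSupport hφ hc (EuclideanSpace.proj ⟨0, hd⟩)
    (e := EuclideanSpace.single ⟨0, hd⟩ 1) (by simp) (by simp)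
    (fun x => PiLp.norm_apply_le x _) fun x hx => hR x (hs hx)

theorem add_mem_testPairs {d : ℕ} {Ω : Set (Space d)} {p q : GraphSpace Ω}
    (hp : p ∈ testPairs Ω) (hq : q ∈ testPairs Ω) : p + q ∈ testPairs Ω := by
  obtain ⟨φ, hφ, hc, hs, h1, h2⟩ := hp
  obtain ⟨ψ, hψ, hc', hs', h1', h2'⟩ := hq
  refine ⟨φ + ψ, hφ.add hψ, hc.add hc', (tsupport_add _ _).trans (Set.union_subset hs hs'), ?_, ?_⟩
  · exact (Lp.coeFn_add _ _).trans (h1.add h1')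
  · refine (Lp.coeFn_add _ _).trans ((h2.add h2').trans (Filter.Eventually.of_forall fun x => ?_))
    simp only [gradient, Pi.add_apply]
    rw [fderiv_add (hφ.differentiable (by simp) x) (hψ.differentiable (by simp) x), map_add]

theorem smul_mem_testPairs {d : ℕ} {Ω : Set (Space d)} (c : ℝ) {p : GraphSpace Ω}
    (hp : p ∈ testPairs Ω) : c • p ∈ testPairs Ω := by
  obtain ⟨φ, hφ, hc, hs, h1, h2⟩ := hp
  refine ⟨c • φ, contDiff_const.smul hφ, hc.smul_left (f := fun _ => c),
    (closure_mono (Function.support_const_smul_subset c φ)).trans hs, ?_, ?_⟩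
  · exact (Lp.coeFn_smul _ _).trans (h1.const_smul c)
  · refine (Lp.coeFn_smul _ _).trans ((h2.const_smul c).trans
      (Filter.Eventually.of_forall fun x => ?_))
    simp only [gradient, Pi.smul_apply]
    rw [fderiv_const_smul (hφ.differentiable (by simp) x), map_smul]

/-- An inequality between norms does not survive linear combinations, so it cannot be carried from
the test pairs to their span. It need not be: the test pairs already form a subspace. -/
theorem span_testPairs_subset {d : ℕ} (Ω : Set (Space d)) :
    (Submodule.span ℝ (testPairs Ω) : Set (GraphSpace Ω)) ⊆ testPairs Ω := by
  intro p hp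
  induction hp using Submodule.span_induction with
  | mem x hx => exact hx
  | zero =>
    exact ⟨0, contDiff_const, HasCompactSupport.zero, by simp [tsupport],
      Lp.coeFn_zero _ _ _, (Lp.coeFn_zero _ _ _).trans
        (Filter.Eventually.of_forall fun x => by simp [gradient])⟩
  | add x y _ _ hx hy => exact add_mem_testPairs hx hy
  | smul c x _ hx => exact smul_mem_testPairs c hx

/-- The inequality is a closed condition on pairs, so it passes from test pairs to their closure.
The constant 2R depends only on a radius of a ball containing Ω. -/
theorem exists_poincare {d : ℕ} (hd : 0 < d) {Ω : Set (Space d)} (hΩ : Bornology.IsBounded Ω) :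
    ∃ c : ℝ, 0 ≤ c ∧ ∀ v : H01 Ω, ‖toFun v‖ ≤ c * ‖grad v‖ := by
  obtain ⟨R, hR0, hR⟩ := hΩ.exists_pos_norm_le
  refine ⟨2 * R, by positivity, fun v => ?_⟩
  have hclosed : IsClosed {p : GraphSpace Ω | ‖p.fst‖ ≤ 2 * R * ‖p.snd‖} :=
    isClosed_le (by fun_prop) (by fun_prop)
  exact hclosed.closure_subset_iff.2
    (fun p hp => norm_fst_le_of_mem_testPairs hd hR0.le hR (span_testPairs_subset Ω hp)) v.2

theorem norm_le_of_poincare {d : ℕ} {Ω : Set (Space d)} {c : ℝ} {v : H01 Ω}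
    (h : ‖toFun v‖ ≤ c * ‖grad v‖) : ‖v‖ ≤ (c + 1) * ‖grad v‖ := by
  have h1 : ‖v‖ ^ 2 = ‖toFun v‖ ^ 2 + ‖grad v‖ ^ 2 :=
    WithLp.prod_norm_sq_eq_of_L2 (v : GraphSpace Ω)
  have h2 : ‖v‖ ≤ ‖toFun v‖ + ‖grad v‖ := by
    refine (pow_le_pow_iff_left₀ (norm_nonneg _) (by positivity) two_ne_zero).1 ?_
    nlinarith [mul_nonneg (norm_nonneg (toFun v)) (norm_nonneg (grad v))]
  linarith

/-! ### The dual norm of `W` -/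

/-- `v ↦ v` as a bounded linear map `H₀¹(Ω) → L²(Ω)`. -/
def toFunL {d : ℕ} (Ω : Set (Space d)) : H01 Ω →L[ℝ] Lp ℝ 2 (volume.restrict Ω) :=
  (WithLp.fstL 2 ℝ _ _).comp (H01 Ω).subtypeL

/-- `v ↦ ∇v` as a bounded linear map `H₀¹(Ω) → L²(Ω; ℝᵈ)`. -/
def gradL {d : ℕ} (Ω : Set (Space d)) : H01 Ω →L[ℝ] Lp (Space d) 2 (volume.restrict Ω) :=
  (WithLp.sndL 2 ℝ _ _).comp (H01 Ω).subtypeL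

@[simp] theorem toFunL_apply {d : ℕ} {Ω : Set (Space d)} (v : H01 Ω) : toFunL Ω v = toFun v := rfl

@[simp] theorem gradL_apply {d : ℕ} {Ω : Set (Space d)} (v : H01 Ω) : gradL Ω v = grad v := rfl

instance (N : ℕ) : IsFiniteMeasure (volume.restrict (paramCube N)) :=
  isFiniteMeasure_restrict.2 isCompact_Icc.measure_lt_top.ne

theorem measurableSet_paramCube (N : ℕ) : MeasurableSet (paramCube N) := measurableSet_Icc

theorem isCompact_paramCube (N : ℕ) : IsCompact (paramCube N) := isCompact_Icc

theorem exists_norm_le_paramCube {N : ℕ} {X : Type*} [NormedAddCommGroup X] {g : Param N → X}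
    (hg : Continuous g) : ∃ R, 0 ≤ R ∧ ∀ t ∈ paramCube N, ‖g t‖ ≤ R := by
  obtain ⟨R, hR⟩ := (isCompact_paramCube N).exists_bound_of_continuousOn hg.continuousOn
  exact ⟨R, (norm_nonneg _).trans (hR 0 ⟨le_rfl, zero_le_one⟩), hR⟩

theorem memLp_paramCube {N : ℕ} {X : Type*} [NormedAddCommGroup X] {g : Param N → X}
    {p : ℝ≥0∞} (hg : Continuous g) : MemLp g p (volume.restrict (paramCube N)) := by
  obtain ⟨C, hC⟩ := (isCompact_paramCube N).exists_bound_of_continuousOn hg.continuousOn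
  have hm : AEStronglyMeasurable g (volume.restrict (paramCube N)) :=
    hg.continuousOn.aestronglyMeasurable_of_isCompact (isCompact_paramCube N)
      (measurableSet_paramCube N)
  exact MemLp.of_bound hm C (ae_restrict_of_forall_mem (measurableSet_paramCube N) hC)

theorem integrableOn_paramCube {N : ℕ} {X : Type*} [NormedAddCommGroup X] {g : Param N → X}
    (hg : Continuous g) : IntegrableOn g (paramCube N) :=
  hg.continuousOn.integrableOn_compact (isCompact_paramCube N)

/-- The Cauchy–Schwarz inequality for integrals. -/
theorem integral_mul_le_sqrt_mul_sqrt {α : Type*} [MeasurableSpace α] {ν : Measure α} {a b : α → ℝ}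
    (ha : MemLp a 2 ν) (hb : MemLp b 2 ν) :
    ∫ x, a x * b x ∂ν ≤ Real.sqrt (∫ x, a x ^ 2 ∂ν) * Real.sqrt (∫ x, b x ^ 2 ∂ν) := by
  have hn : ∀ {g : α → ℝ} (hg : MemLp g 2 ν), Real.sqrt (∫ x, g x ^ 2 ∂ν) = ‖hg.toLp g‖ := by
    intro g hg
    rw [← Real.sqrt_sq (norm_nonneg (hg.toLp g)), norm_sq_eq_integral]
    congr 1
    exact integral_congr_ae (hg.coeFn_toLp.mono fun x hx => by
      simp only [hx, Real.norm_eq_abs, sq_abs])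
  have h := real_inner_le_norm (ha.toLp a) (hb.toLp b)
  rw [L2.inner_def] at h
  rw [hn ha, hn hb]
  refine le_of_eq_of_le (integral_congr_ae ?_) h
  filter_upwards [ha.coeFn_toLp, hb.coeFn_toLp] with x h1 h2
  simp [h1, h2, mul_comm]

section DualNorm

variable {d N : ℕ} {Ω : Set (Space d)}

/-- The norm `‖∇v‖_{L²(Ω × Ω_t)}` of a function `v : ℝᴺ → H₀¹(Ω)`. -/
def energyNorm (v : Param N → H01 Ω) : ℝ :=
  Real.sqrt (∫ t in paramCube N, ‖grad (v t)‖ ^ 2)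

theorem energyNorm_nonneg (v : Param N → H01 Ω) : 0 ≤ energyNorm v := Real.sqrt_nonneg _

theorem energyNorm_sq (v : Param N → H01 Ω) :
    energyNorm v ^ 2 = ∫ t in paramCube N, ‖grad (v t)‖ ^ 2 :=
  Real.sq_sqrt (integral_nonneg fun _ => by positivity)

theorem energyNorm_congr {v w : Param N → H01 Ω} (h : v =ᵐ[volume.restrict (paramCube N)] w) :
    energyNorm v = energyNorm w := by
  unfold energyNorm
  congr 1
  exact integral_congr_ae (h.mono fun t ht => by simp only [ht])

theorem memLp_norm_grad {v : Param N → H01 Ω} (hv : MemLp v 2 (volume.restrict (paramCube N))) :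
    MemLp (fun t => ‖grad (v t)‖) 2 (volume.restrict (paramCube N)) :=
  ((gradL Ω).comp_memLp' hv).norm

theorem ae_eq_zero_of_energyNorm_eq_zero {c : ℝ} (hc : ∀ v : H01 Ω, ‖toFun v‖ ≤ c * ‖grad v‖)
    {v : Param N → H01 Ω} (hv : MemLp v 2 (volume.restrict (paramCube N)))
    (h : energyNorm v = 0) : v =ᵐ[volume.restrict (paramCube N)] 0 := by
  have h1 : ∫ t in paramCube N, ‖grad (v t)‖ ^ 2 = 0 := by rw [← energyNorm_sq, h]; simp
  rw [integral_eq_zero_iff_of_nonneg (fun _ => by positivity) (memLp_norm_grad hv).integrable_sq]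
    at h1
  filter_upwards [h1] with t ht
  have h2 : ‖grad (v t)‖ = 0 := by simpa using ht
  have h3 := norm_le_of_poincare (hc (v t))
  rw [h2, mul_zero] at h3
  exact norm_le_zero_iff.1 h3

theorem abs_wPairing_le {c : ℝ} (hc0 : 0 ≤ c) (hc : ∀ v : H01 Ω, ‖toFun v‖ ≤ c * ‖grad v‖)
    {F : Param N → HNegOne Ω} {R : ℝ} (hF : ∀ t ∈ paramCube N, ‖F t‖ ≤ R) (v : WSpace Ω N) :
    |wPairing F v| ≤ R * (c + 1) * Real.sqrt (∫ _ in paramCube N, (1 : ℝ) ^ 2) * wNorm v := by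
  have hR : 0 ≤ R := (norm_nonneg (F 0)).trans (hF 0 ⟨le_rfl, zero_le_one⟩)
  have hg := memLp_norm_grad (Lp.memLp v)
  have hcs := integral_mul_le_sqrt_mul_sqrt
    (memLp_const (p := 2) (μ := volume.restrict (paramCube N)) (1 : ℝ)) hg
  have hle : ‖wPairing F v‖ ≤ ∫ t in paramCube N, R * (c + 1) * (1 * ‖grad (v t)‖) := by
    refine norm_integral_le_of_norm_le
      (((hg.integrable one_le_two).const_mul 1).const_mul _) ?_
    refine ae_restrict_of_forall_mem (measurableSet_paramCube N) fun t ht => ?_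
    calc ‖F t (v t)‖ ≤ R * ‖v t‖ := (F t).le_of_opNorm_le (hF t ht) _
      _ ≤ R * ((c + 1) * ‖grad (v t)‖) := by gcongr; exact norm_le_of_poincare (hc _)
      _ = _ := by ring
  rw [integral_const_mul] at hle
  refine hle.trans ?_
  rw [mul_assoc (R * (c + 1))]
  exact mul_le_mul_of_nonneg_left hcs (by positivity)

/-- A real supremum over an unbounded set is 0 by convention, so `wDualNorm` controls the individual
quotients only once this is known. -/
theorem bddAbove_wDualNorm {c : ℝ} (hc0 : 0 ≤ c) (hc : ∀ v : H01 Ω, ‖toFun v‖ ≤ c * ‖grad v‖)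
    {F : Param N → HNegOne Ω} (hF : Continuous F) :
    BddAbove (Set.range fun v : {v : WSpace Ω N // v ≠ 0} => wPairing F v.1 / wNorm v.1) := by
  have hb : ∃ R, 0 ≤ R ∧ ∀ t ∈ paramCube N, ‖F t‖ ≤ R :=
    exists_norm_le_paramCube (X := HNegOne Ω) hF
  obtain ⟨R, hR0, hR⟩ := hb
  refine ⟨R * (c + 1) * Real.sqrt (∫ _ in paramCube N, (1 : ℝ) ^ 2), ?_⟩
  rintro _ ⟨v, rfl⟩
  exact div_le_of_le_mul₀ (Real.sqrt_nonneg _) (by positivity)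
    ((le_abs_self _).trans (abs_wPairing_le hc0 hc hR v.1))

/-- The quotients of v and −v are opposite and both lie below the supremum; if W is trivial, the
empty supremum is 0. -/
theorem wDualNorm_nonneg {c : ℝ} (hc0 : 0 ≤ c) (hc : ∀ v : H01 Ω, ‖toFun v‖ ≤ c * ‖grad v‖)
    {F : Param N → HNegOne Ω} (hF : Continuous F) : 0 ≤ wDualNorm F := by
  have hb := bddAbove_wDualNorm hc0 hc hF
  rcases isEmpty_or_nonempty {v : WSpace Ω N // v ≠ 0} with he | ⟨⟨v, hv⟩⟩
  · simp [wDualNorm]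
  · have h1 : wPairing F v / wNorm v ≤ wDualNorm F := le_ciSup hb ⟨v, hv⟩
    have h2 : wPairing F (-v) / wNorm (-v) ≤ wDualNorm F := le_ciSup hb ⟨-v, neg_ne_zero.2 hv⟩
    have h3 : wPairing F (-v) = -wPairing F v := by
      simp only [wPairing]
      rw [← integral_neg]
      refine integral_congr_ae ((Lp.coeFn_neg v).mono fun t ht => ?_)
      simp only [ht, Pi.neg_apply, map_neg]
    have h4 : wNorm (-v) = wNorm v := by
      simp only [wNorm]
      congr 1
      refine integral_congr_ae ((Lp.coeFn_neg v).mono fun t ht => ?_)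
      have : grad (-(v t)) = -grad (v t) := map_neg (gradL Ω) (v t)
      simp only [ht, Pi.neg_apply, this, norm_neg]
    have h5 : wPairing F (-v) / wNorm (-v) = -(wPairing F v / wNorm v) :=
      (congrArg₂ (· / ·) h3 h4).trans (neg_div _ _)
    linarith

theorem integral_le_wDualNorm_mul {c : ℝ} (hc0 : 0 ≤ c)
    (hc : ∀ v : H01 Ω, ‖toFun v‖ ≤ c * ‖grad v‖)
    {F : Param N → HNegOne Ω} (hF : Continuous F) {v : Param N → H01 Ω}
    (hv : Continuous v) :
    ∫ t in paramCube N, F t (v t) ≤ wDualNorm F * energyNorm v := by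
  have hv2 : MemLp v 2 (volume.restrict (paramCube N)) := memLp_paramCube hv
  have hae := hv2.coeFn_toLp
  have hp : ∫ t in paramCube N, F t (v t) = wPairing F (hv2.toLp v) :=
    integral_congr_ae (hae.mono fun t ht => by simp only [ht])
  have hn : energyNorm v = wNorm (hv2.toLp v) := energyNorm_congr hae.symm
  -- The quotient is useless when the energy norm vanishes, but then v = 0 a.e. by Poincaré.
  by_cases h0 : energyNorm v = 0
  · have hz := ae_eq_zero_of_energyNorm_eq_zero hc hv2 h0
    rw [h0, mul_zero]
    refine (integral_eq_zero_of_ae (hz.mono fun t ht => ?_)).le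
    simp [ht]
  · have hpos : 0 < energyNorm v := (energyNorm_nonneg v).lt_of_ne' h0
    have hne : hv2.toLp v ≠ 0 := by
      intro h
      apply h0
      rw [hn, h]
      have : energyNorm (⇑(0 : WSpace Ω N)) = energyNorm (0 : Param N → H01 Ω) :=
        energyNorm_congr (Lp.coeFn_zero _ _ _)
      refine Eq.trans this ?_
      have hg0 : grad (0 : H01 Ω) = 0 := map_zero (gradL Ω)
      simp [energyNorm, hg0]
    have h := le_ciSup (bddAbove_wDualNorm hc0 hc hF) ⟨hv2.toLp v, hne⟩
    rw [hp]
    rw [hn] at hpos ⊢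
    exact (div_le_iff₀ hpos).1 h

end DualNorm

/-! ### Iterated partial derivatives along words -/

section WordDeriv

variable {N : ℕ} {X Y : Type*} [NormedAddCommGroup X] [NormedSpace ℝ X]
  [NormedAddCommGroup Y] [NormedSpace ℝ Y]

/-- The iterated partial derivative `∂_{i₁} ⋯ ∂_{iₙ} g` along the word `i₁ ⋯ iₙ`. -/
def wordDeriv (L : List (Fin N)) (g : Param N → X) : Param N → X :=
  L.foldr partialDeriv g

@[simp] theorem wordDeriv_nil (g : Param N → X) : wordDeriv [] g = g := rfl

@[simp] theorem wordDeriv_cons (i : Fin N) (L : List (Fin N)) (g : Param N → X) :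
    wordDeriv (i :: L) g = partialDeriv i (wordDeriv L g) := rfl

theorem wordDeriv_append (L L' : List (Fin N)) (g : Param N → X) :
    wordDeriv (L ++ L') g = wordDeriv L (wordDeriv L' g) :=
  List.foldr_append

/-- The word `1 ⋯ 1 2 ⋯ 2 ⋯` in which the letter `i` occurs `αᵢ` times. -/
def multiWord (α : Fin N → ℕ) : List (Fin N) :=
  (List.finRange N).flatMap fun i => List.replicate (α i) i

theorem length_multiWord (α : Fin N → ℕ) : (multiWord α).length = ∑ i, α i := by
  simp [multiWord, List.length_flatMap, ← List.ofFn_eq_map, List.sum_ofFn]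

theorem multiDeriv_eq_wordDeriv (α : Fin N → ℕ) (g : Param N → X) :
    multiDeriv α g = wordDeriv (multiWord α) g := by
  have hrep : ∀ (i : Fin N) (n : ℕ) (G : Param N → X),
      (partialDeriv i)^[n] G = wordDeriv (List.replicate n i) G := by
    intro i n G
    induction n with
    | zero => rfl
    | succ n ih => rw [Function.iterate_succ_apply', ih, List.replicate_succ, wordDeriv_cons]
  unfold multiDeriv multiWord
  induction List.finRange N with
  | nil => rfl
  | cons i l ih => rw [List.foldr_cons, ih, hrep, List.flatMap_cons, wordDeriv_append]

theorem contDiff_partialDeriv {g : Param N → X} (hg : ContDiff ℝ ∞ g) (i : Fin N) :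
    ContDiff ℝ ∞ (partialDeriv i g) :=
  (hg.fderiv_right (m := ∞) (by simp)).clm_apply contDiff_const

theorem contDiff_wordDeriv {g : Param N → X} (hg : ContDiff ℝ ∞ g) (L : List (Fin N)) :
    ContDiff ℝ ∞ (wordDeriv L g) := by
  induction L with
  | nil => exact hg
  | cons i L ih => exact contDiff_partialDeriv ih i

theorem partialDeriv_clm_comp (T : X →L[ℝ] Y) {g : Param N → X} (hg : ContDiff ℝ ∞ g) (i : Fin N) :
    partialDeriv i (fun t => T (g t)) = fun t => T (partialDeriv i g t) := by
  funext t
  have h := (T.hasFDerivAt.comp t (hg.differentiable (by simp) t).hasFDerivAt).fderiv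
  unfold partialDeriv
  exact congrArg (fun A => A (Pi.single i 1)) h

theorem tsupport_partialDeriv_subset (g : Param N → X) (i : Fin N) :
    tsupport (partialDeriv i g) ⊆ tsupport g :=
  tsupport_fderiv_apply_subset ℝ _

theorem tsupport_wordDeriv_subset (g : Param N → X) (L : List (Fin N)) :
    tsupport (wordDeriv L g) ⊆ tsupport g := by
  induction L with
  | nil => exact le_rfl
  | cons i L ih => exact (tsupport_partialDeriv_subset _ i).trans ih

theorem integral_partialDeriv_smul {φ : Param N → ℝ} {g : Param N → X} (hφ : ContDiff ℝ ∞ φ)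
    (hc : HasCompactSupport φ) (hg : ContDiff ℝ ∞ g) (i : Fin N) :
    ∫ t, partialDeriv i φ t • g t = -∫ t, φ t • partialDeriv i g t := by
  have hi : ∀ {ψ : Param N → ℝ} {h : Param N → X}, Continuous ψ → HasCompactSupport ψ →
      Continuous h → Integrable fun t => ψ t • h t := fun h1 h2 h3 =>
    (h1.smul h3).integrable_of_hasCompactSupport h2.smul_right
  have hφ' := (contDiff_partialDeriv hφ i).continuous
  have hc' : HasCompactSupport (partialDeriv i φ) :=
    hc.of_isClosed_subset (isClosed_tsupport _) (tsupport_partialDeriv_subset φ i)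
  have h := integral_smul_fderiv_eq_neg_fderiv_smul_of_integrable (μ := (volume : Measure (Param N)))
    (f := φ) (g := g) (v := Pi.single i 1) (hi hφ' hc' hg.continuous)
    (hi hφ.continuous hc (contDiff_partialDeriv hg i).continuous)
    (hi hφ.continuous hc hg.continuous) (fun t _ => hφ.differentiable (by simp) t)
    (fun t _ => hg.differentiable (by simp) t)
  simp only [partialDeriv]
  rw [h, neg_neg]

/-- The outermost letter is moved first and so becomes the innermost one on g: the word arrives
reversed. -/
theorem integral_wordDeriv_smul {φ : Param N → ℝ} (hφ : ContDiff ℝ ∞ φ)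
    (hc : HasCompactSupport φ) (L : List (Fin N)) :
    ∀ {g : Param N → X}, ContDiff ℝ ∞ g →
      ∫ t, wordDeriv L φ t • g t =
        (-1 : ℝ) ^ L.length • ∫ t, φ t • wordDeriv L.reverse g t := by
  induction L with
  | nil => intro g _; simp
  | cons i L ih =>
    intro g hg
    rw [wordDeriv_cons, integral_partialDeriv_smul (contDiff_wordDeriv hφ L)
      (hc.of_isClosed_subset (isClosed_tsupport _) (tsupport_wordDeriv_subset φ L)) hg,
      ih (contDiff_partialDeriv hg i), List.reverse_cons, wordDeriv_append, List.length_cons,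
      pow_succ]
    simp

theorem setIntegral_smul_eq_integral {φ : Param N → ℝ} (hs : tsupport φ ⊆ interior (paramCube N))
    (g : Param N → X) : ∫ t in paramCube N, φ t • g t = ∫ t, φ t • g t :=
  setIntegral_eq_integral_of_forall_compl_eq_zero fun t ht => by
    rw [image_eq_zero_of_notMem_tsupport fun h => ht (interior_subset (hs h)), zero_smul]

theorem hasWeakDeriv_of_contDiff {g u : Param N → X} (hg : ContDiff ℝ ∞ g)
    (hu : u =ᵐ[volume.restrict (paramCube N)] g) (α : Fin N → ℕ) :
    HasWeakDeriv α u (wordDeriv (multiWord α).reverse g) := by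
  refine ⟨memLp_paramCube (contDiff_wordDeriv hg _).continuous, fun φ hφ hc hs => ?_⟩
  have h1 : ∫ t in paramCube N, multiDeriv α φ t • u t =
      ∫ t in paramCube N, wordDeriv (multiWord α) φ t • g t :=
    integral_congr_ae (hu.mono fun t ht => by simp only [ht, multiDeriv_eq_wordDeriv])
  rw [h1, setIntegral_smul_eq_integral ((tsupport_wordDeriv_subset φ _).trans hs),
    setIntegral_smul_eq_integral hs, integral_wordDeriv_smul hφ hc _ hg, length_multiWord]

theorem memHk_of_contDiff {g u : Param N → X} (hg : ContDiff ℝ ∞ g)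
    (hu : u =ᵐ[volume.restrict (paramCube N)] g) (k : ℕ) : MemHk k u :=
  ⟨(memLp_congr_ae hu).2 (memLp_paramCube hg.continuous),
    fun α _ => ⟨_, hasWeakDeriv_of_contDiff hg hu α⟩⟩

theorem interior_paramCube (N : ℕ) :
    interior (paramCube N) = Set.univ.pi fun _ => Set.Ioo (0 : ℝ) 1 := by
  unfold paramCube
  rw [← Set.pi_univ_Icc, interior_pi_set Set.finite_univ]
  simp

theorem interior_paramCube_ae_eq (N : ℕ) :
    interior (paramCube N) =ᵐ[volume] paramCube N := by
  rw [interior_paramCube]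
  exact Measure.univ_pi_Ioo_ae_eq_Icc

theorem paramCube_subset_closure_interior (N : ℕ) :
    paramCube N ⊆ closure (interior (paramCube N)) := by
  rw [interior_paramCube, closure_pi_set]
  simp [paramCube, ← Set.pi_univ_Icc]

/-- The fundamental lemma of the calculus of variations applies on the open cube, and the boundary
is a null set. This makes a bound for the classical derivative valid for every weak derivative. -/
theorem HasWeakDeriv.ae_eq [CompleteSpace X] {α : Fin N → ℕ} {u w w' : Param N → X}
    (h : HasWeakDeriv α u w)
    (h' : HasWeakDeriv α u w') : w =ᵐ[volume.restrict (paramCube N)] w' := by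
  have hd : MemLp (w - w') 2 (volume.restrict (paramCube N)) := h.1.sub h'.1
  have hint : IntegrableOn (w - w') (paramCube N) := hd.integrable one_le_two
  have hloc : LocallyIntegrableOn (w - w') (interior (paramCube N)) volume :=
    (hint.mono_set interior_subset).locallyIntegrableOn
  have hz := isOpen_interior.ae_eq_zero_of_integral_contDiff_smul_eq_zero hloc fun φ hφ hc hs => by
    obtain ⟨C, hC⟩ := hc.exists_bound_of_continuous hφ.continuous
    have hi : ∀ {v : Param N → X}, MemLp v 2 (volume.restrict (paramCube N)) →
        IntegrableOn (fun t => φ t • v t) (paramCube N) := fun hv =>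
      (hv.integrable one_le_two).bdd_smul C hφ.continuous.aestronglyMeasurable
        (Filter.Eventually.of_forall hC)
    have e := (h.2 φ hφ hc hs).symm.trans (h'.2 φ hφ hc hs)
    have e' := smul_right_injective X (pow_ne_zero (∑ i, α i) (neg_ne_zero.2 one_ne_zero)) e
    rw [← setIntegral_smul_eq_integral hs]
    simp only [Pi.sub_apply, smul_sub]
    rw [integral_sub (hi h.1) (hi h'.1)]
    exact sub_eq_zero.2 e'
  have h2 : ∀ᵐ t ∂volume.restrict (interior (paramCube N)), w t = w' t := by
    rw [ae_restrict_iff' isOpen_interior.measurableSet]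
    filter_upwards [hz] with t ht hmem
    exact sub_eq_zero.1 (ht hmem)
  rwa [Measure.restrict_congr_set (interior_paramCube_ae_eq N)] at h2

end WordDeriv

/-! ### Linear equations with affine parameter dependence -/

section Affine

variable {N : ℕ} {X Y Z : Type*} [NormedAddCommGroup X] [NormedSpace ℝ X]
  [NormedAddCommGroup Y] [NormedSpace ℝ Y] [NormedAddCommGroup Z] [NormedSpace ℝ Z]

/-- The affine function `t ↦ c₀ + ∑ᵢ tᵢ cᵢ`. -/
def affine (c : Fin (N + 1) → X) (t : Param N) : X := c 0 + ∑ i : Fin N, t i • c i.succ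

theorem contDiff_affine (c : Fin (N + 1) → X) : ContDiff ℝ ∞ (affine c) := by
  unfold affine
  fun_prop

theorem clm_affine (T : X →L[ℝ] Y) (c : Fin (N + 1) → X) (t : Param N) :
    T (affine c t) = affine (fun i => T (c i)) t := by
  simp [affine]

theorem partialDeriv_affine (i : Fin N) (c : Fin (N + 1) → X) :
    partialDeriv i (affine c) = fun _ => c i.succ := by
  funext t
  have h : HasFDerivAt (affine c)
      (∑ j : Fin N, (ContinuousLinearMap.proj (R := ℝ) (φ := fun _ : Fin N => ℝ) j).smulRight
        (c j.succ)) t := by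
    unfold affine
    refine HasFDerivAt.const_add _ (HasFDerivAt.fun_sum fun j _ => ?_)
    exact (ContinuousLinearMap.proj (R := ℝ) (φ := fun _ : Fin N => ℝ) j).hasFDerivAt.smul_const _
  rw [partialDeriv, h.fderiv]
  simp [Pi.single_apply]

theorem wordDeriv_zero (L : List (Fin N)) : wordDeriv L (fun _ => (0 : X)) = fun _ => 0 := by
  induction L with
  | nil => rfl
  | cons i L ih => rw [wordDeriv_cons, ih]; funext t; simp [partialDeriv]

theorem wordDeriv_affine (L : List (Fin N)) (c : Fin (N + 1) → X) :
    wordDeriv L (affine c) = affine c ∨ (∃ i, wordDeriv L (affine c) = partialDeriv i (affine c)) ∨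
      wordDeriv L (affine c) = fun _ => 0 := by
  -- The word is split from its end because the last letter acts first: it turns the affine function
  -- into a constant, and the next letter kills it.
  rcases L.eq_nil_or_concat' with rfl | ⟨L, i, rfl⟩
  · exact Or.inl rfl
  right
  rw [wordDeriv_append, wordDeriv_cons, wordDeriv_nil]
  rcases L.eq_nil_or_concat' with rfl | ⟨L, j, rfl⟩
  · exact Or.inl ⟨i, rfl⟩
  right
  rw [wordDeriv_append, wordDeriv_cons, wordDeriv_nil, partialDeriv_affine]
  have : partialDeriv j (fun _ : Param N => c i.succ) = fun _ => 0 := by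
    funext t; simp [partialDeriv]
  rw [this, wordDeriv_zero]

theorem contDiff_clm_comp (T : X →L[ℝ] Y) {g : Param N → X} (hg : ContDiff ℝ ∞ g) :
    ContDiff ℝ ∞ fun t => T (g t) :=
  T.contDiff.comp hg

theorem wordDeriv_clm_comp (T : X →L[ℝ] Y) {g : Param N → X} (hg : ContDiff ℝ ∞ g)
    (L : List (Fin N)) : wordDeriv L (fun t => T (g t)) = fun t => T (wordDeriv L g t) := by
  induction L with
  | nil => rfl
  | cons i L ih => rw [wordDeriv_cons, ih, partialDeriv_clm_comp T (contDiff_wordDeriv hg L)]; rfl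

theorem partialDeriv_affine_apply (B : Fin (N + 1) → X →L[ℝ] Y) {h : Param N → X}
    (hh : ContDiff ℝ ∞ h) (i : Fin N) (t : Param N) :
    partialDeriv i (fun s => affine B s (h s)) t =
      B i.succ (h t) + affine B t (partialDeriv i h t) := by
  have hB := ((contDiff_affine B).differentiable (by simp) t).hasFDerivAt
  have hB' : fderiv ℝ (affine B) t (Pi.single i 1) = B i.succ :=
    congrFun (partialDeriv_affine i B) t
  have h1 := (hB.clm_apply (hh.differentiable (by simp) t).hasFDerivAt).fderiv
  rw [partialDeriv, h1]
  simp [hB', partialDeriv, add_comm]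

/-- Differentiating `B(t) x(t) = f(t)`, with `B` affine in `t`, along a word. -/
theorem affine_apply_wordDeriv (B : Fin (N + 1) → X →L[ℝ] Y) {x : Param N → X} {f : Param N → Y}
    (hx : ContDiff ℝ ∞ x) (hf : ContDiff ℝ ∞ f) {G : Set (Param N)} (hG : IsOpen G)
    (h : ∀ t ∈ G, affine B t (x t) = f t) (L : List (Fin N)) :
    ∀ t ∈ G, affine B t (wordDeriv L x t) =
      wordDeriv L f t - ∑ j : Fin L.length, B (L.get j).succ (wordDeriv (L.eraseIdx j) x t) := by
  induction L with
  | nil => intro t ht; simpa using h t ht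
  | cons i L ih =>
    intro t ht
    have hsm : ∀ j : Fin L.length, DifferentiableAt ℝ
        (fun s => B (L.get j).succ (wordDeriv (L.eraseIdx j) x s)) t := fun j =>
      (B (L.get j).succ).differentiableAt.comp t
        ((contDiff_wordDeriv hx _).differentiable (by simp) t)
    have e1 : partialDeriv i (fun s => affine B s (wordDeriv L x s)) t =
        partialDeriv i (fun s => wordDeriv L f s -
          ∑ j : Fin L.length, B (L.get j).succ (wordDeriv (L.eraseIdx j) x s)) t := by
      unfold partialDeriv
      -- G is open, so the induction hypothesis is an identity of germs at t and may be
      -- differentiated.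
      rw [Filter.EventuallyEq.fderiv_eq (Filter.eventually_of_mem (hG.mem_nhds ht) ih)]
    rw [partialDeriv_affine_apply B (contDiff_wordDeriv hx L)] at e1
    have e2 : partialDeriv i (fun s => wordDeriv L f s -
          ∑ j : Fin L.length, B (L.get j).succ (wordDeriv (L.eraseIdx j) x s)) t =
        wordDeriv (i :: L) f t - ∑ j : Fin L.length,
          B (L.get j).succ (wordDeriv (i :: L.eraseIdx j) x t) := by
      rw [partialDeriv, fderiv_fun_sub ((contDiff_wordDeriv hf L).differentiable (by simp) t)
        (DifferentiableAt.fun_sum fun j _ => hsm j), fderiv_fun_sum fun j _ => hsm j]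
      simp only [sub_apply, sum_apply]
      congr 1
      refine Finset.sum_congr rfl fun j _ => ?_
      exact congrFun (partialDeriv_clm_comp (B (L.get j).succ)
        (contDiff_wordDeriv hx (L.eraseIdx j)) i) t
    rw [e2] at e1
    -- Erasing the head letter i gives the new Leibniz term; every other erasure keeps i in front.
    have e3 : ∑ j : Fin (i :: L).length,
        B ((i :: L).get j).succ (wordDeriv ((i :: L).eraseIdx j) x t) =
        B i.succ (wordDeriv L x t) + ∑ j : Fin L.length,
          B (L.get j).succ (wordDeriv (i :: L.eraseIdx j) x t) :=
      Fin.sum_univ_succ (n := L.length) _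
    rw [e3, wordDeriv_cons, eq_sub_of_add_eq' e1]
    abel

open Filter Topology in
open scoped Manifold in
/-- A linear equation whose matrix and right-hand side are affine in `t`, and whose matrix is
invertible on the cube, has near the cube a solution that extends to a smooth function. -/
theorem exists_contDiff_solution [CompleteSpace X] (B : Fin (N + 1) → X →L[ℝ] Y)
    (F : Fin (N + 1) → Y)
    (hB : ∀ t ∈ paramCube N, ∃ e : X ≃L[ℝ] Y, (e : X →L[ℝ] Y) = affine B t) :
    ∃ x : Param N → X, ContDiff ℝ ∞ x ∧ ∃ G, IsOpen G ∧ paramCube N ⊆ G ∧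
      ∀ t ∈ G, affine B t (x t) = affine F t := by
  have hBc := contDiff_affine B
  set U : Set (Param N) := affine B ⁻¹' Set.range ((↑) : (X ≃L[ℝ] Y) → X →L[ℝ] Y) with hU
  have hUo : IsOpen U := ContinuousLinearEquiv.isOpen.preimage hBc.continuous
  have hx0 : ∀ t ∈ U, ContDiffAt ℝ ∞ (fun s => (affine B s).inverse (affine F s)) t := by
    rintro t ⟨e, he⟩
    have h1 : ContDiffAt ℝ ∞ ContinuousLinearMap.inverse (affine B t) := he ▸ contDiffAt_map_inverse e
    exact (h1.comp t hBc.contDiffAt).clm_apply (contDiff_affine F).contDiffAt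
  -- The inverse is smooth only on U. The cutoff vanishes near the complement of U and is 1 near the
  -- cube, which leaves the equation intact on an open set around boundary points too.
  obtain ⟨χ, h0, h1, -⟩ := exists_contMDiffMap_zero_one_nhds_of_isClosed (n := (⊤ : ℕ∞))
    (𝓘(ℝ, Param N)) hUo.isClosed_compl (isCompact_paramCube N).isClosed
    (Set.disjoint_left.2 fun t ht ht' => ht (hB t ht'))
  have hχ : ContDiff ℝ ∞ χ := χ.contMDiff.contDiff
  refine ⟨fun t => χ t • (affine B t).inverse (affine F t), contDiff_iff_contDiffAt.2 fun t => ?_, ?_⟩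
  · by_cases ht : t ∈ U
    · exact hχ.contDiffAt.smul (hx0 t ht)
    · have : (fun t => χ t • (affine B t).inverse (affine F t)) =ᶠ[𝓝 t] fun _ => 0 :=
        (eventually_nhdsSet_iff_forall.1 h0 t ht).mono fun s hs => by simp [hs]
      exact contDiffAt_const.congr_of_eventuallyEq this
  · obtain ⟨G, hGo, hG, hG1⟩ := eventually_nhdsSet_iff_exists.1 h1
    refine ⟨G ∩ U, hGo.inter hUo, Set.subset_inter hG hB, ?_⟩
    rintro t ⟨htG, e, he⟩
    simp only [hG1 t htG, one_smul, ← he, ContinuousLinearMap.inverse_equiv]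
    exact e.apply_symm_apply _

end Affine

/-! ### The bilinear forms of the Galerkin equation -/

section Forms

variable {d N : ℕ} {Ω : Set (Space d)}

/-- The bilinear form `(u, v) ↦ ∫ m u v` on `L²`. -/
def weightedForm {α : Type*} [MeasurableSpace α] {ν : Measure α} (m : Lp ℝ ∞ ν) :
    Lp ℝ 2 ν →L[ℝ] Lp ℝ 2 ν →L[ℝ] ℝ :=
  (innerSL ℝ).comp ((ContinuousLinearMap.mul ℝ ℝ).holderL ν ∞ 2 2 m)

theorem abs_weightedForm_le {α : Type*} [MeasurableSpace α] {ν : Measure α} (m : Lp ℝ ∞ ν)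
    (u v : Lp ℝ 2 ν) : |weightedForm m u v| ≤ ‖m‖ * ‖u‖ * ‖v‖ := by
  refine (norm_inner_le_norm (𝕜 := ℝ) _ v).trans ?_
  gcongr
  refine ((ContinuousLinearMap.mul ℝ ℝ).norm_holder_apply_apply_le m u).trans ?_
  have := ContinuousLinearMap.opNorm_mul_le ℝ ℝ
  gcongr
  exact mul_le_of_le_one_left (norm_nonneg _) this

theorem weightedForm_ae {α : Type*} [MeasurableSpace α] {ν : Measure α} {g : α → ℝ}
    (hg : MemLp g ∞ ν) (u v : Lp ℝ 2 ν) :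
    (fun x => inner ℝ ((ContinuousLinearMap.mul ℝ ℝ).holderL ν ∞ 2 2 (hg.toLp g) u x) (v x)) =ᵐ[ν]
      fun x => g x * u x * v x := by
  have h := (ContinuousLinearMap.mul ℝ ℝ).coeFn_holder (r := 2) (hg.toLp g) u
  filter_upwards [h, hg.coeFn_toLp] with x hx hx'
  change inner ℝ ((ContinuousLinearMap.mul ℝ ℝ).holder 2 (hg.toLp g) u x) (v x) = _
  rw [hx, hx']
  simp [mul_comm]

theorem weightedForm_toLp {α : Type*} [MeasurableSpace α] {ν : Measure α} {g : α → ℝ}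
    (hg : MemLp g ∞ ν) (u v : Lp ℝ 2 ν) :
    weightedForm (hg.toLp g) u v = ∫ x, g x * u x * v x ∂ν :=
  (L2.inner_def _ _).trans (integral_congr_ae (weightedForm_ae hg u v))

theorem integrable_mul_mul {α : Type*} [MeasurableSpace α] {ν : Measure α} {g : α → ℝ}
    (hg : MemLp g ∞ ν) (u v : Lp ℝ 2 ν) : Integrable (fun x => g x * u x * v x) ν :=
  (L2.integrable_inner _ _).congr (weightedForm_ae hg u v)

theorem affine_integral_mul_mul {μ : Fin (N + 1) → Space d → ℝ}
    (hμ : ∀ i, MemLp (μ i) ⊤ (volume.restrict Ω)) (t : Param N)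
    (u v : Lp ℝ 2 (volume.restrict Ω)) :
    affine (fun i => weightedForm ((hμ i).toLp (μ i)) u v) t =
      ∫ x in Ω, potential μ x t * u x * v x := by
  have hi := fun i => integrable_mul_mul (hμ i) u v
  simp only [affine, weightedForm_toLp, smul_eq_mul, ← integral_const_mul, potential, add_mul,
    Finset.sum_mul]
  rw [integral_add (hi 0), integral_finsetSum]
  · congr 1
    exact Finset.sum_congr rfl fun i _ => integral_congr_ae (.of_forall fun x => by ring)
  · exact fun i _ => ((hi i.succ).const_mul (t i)).congr (.of_forall fun x => by ring)
  · exact integrable_finsetSum _ fun i _ =>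
      ((hi i.succ).const_mul (t i)).congr (.of_forall fun x => by ring)

/-- The continuous functions min(g, 0) and 0 agree a.e., hence everywhere, since the cube lies in
the closure of its interior. -/
theorem forall_mem_paramCube_of_ae {g : Param N → ℝ} (hg : Continuous g)
    (h : ∀ᵐ t ∂volume.restrict (paramCube N), 0 ≤ g t) : ∀ t ∈ paramCube N, 0 ≤ g t := by
  have h1 : (fun t => min (g t) 0) =ᵐ[volume.restrict (paramCube N)] fun _ => 0 :=
    h.mono fun t ht => min_eq_right ht
  intro t ht
  exact min_eq_right_iff.1 (Measure.eqOn_of_ae_eq h1 (by fun_prop) (by fun_prop)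
    (paramCube_subset_closure_interior N) ht)

/-- Fubini gives the sign of the potential only for a.e. t; the integral is affine, hence
continuous, in t, which extends its sign to the whole cube. -/
theorem potential_integral_nonneg {μ : Fin (N + 1) → Space d → ℝ}
    (hμ : ∀ i, MemLp (μ i) ⊤ (volume.restrict Ω))
    (hpos : ∀ᵐ p ∂(volume.restrict Ω).prod (volume.restrict (paramCube N)),
      0 ≤ potential μ p.1 p.2) (u : Lp ℝ 2 (volume.restrict Ω)) :
    ∀ t ∈ paramCube N, 0 ≤ ∫ x in Ω, potential μ x t * u x * u x := by
  have hae : ∀ᵐ t ∂volume.restrict (paramCube N), ∀ᵐ x ∂volume.restrict Ω,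
      0 ≤ potential μ x t :=
    Measure.ae_ae_of_ae_prod (Measure.measurePreserving_swap.quasiMeasurePreserving.ae hpos)
  have heq := fun t => affine_integral_mul_mul hμ t u u
  refine forall_mem_paramCube_of_ae ?_ (hae.mono fun t ht => ?_)
  · simp only [← heq]
    exact (contDiff_affine _).continuous
  · exact integral_nonneg_of_ae (ht.mono fun x hx => by
      simp only [Pi.zero_apply, mul_assoc]
      exact mul_nonneg hx (mul_self_nonneg _))

/-- The bilinear form `(u, v) ↦ (∇u, ∇v)` on `H₀¹(Ω)`. -/
def gradForm (Ω : Set (Space d)) : H01 Ω →L[ℝ] H01 Ω →L[ℝ] ℝ :=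
  ContinuousLinearMap.bilinearComp (𝕜 := ℝ) (innerSL ℝ :
    Lp (Space d) 2 (volume.restrict Ω) →L[ℝ] Lp (Space d) 2 (volume.restrict Ω) →L[ℝ] ℝ)
    (gradL Ω) (gradL Ω)

theorem gradForm_apply (u v : H01 Ω) : gradForm Ω u v = inner ℝ (grad u) (grad v) := rfl

/-- The coefficients of the bilinear form `(∇u, ∇v) + (μ(·,t) u, v)`, which is affine in `t`, pulled
back along `Φ`. -/
def galerkinForm {E : Type*} [NormedAddCommGroup E] [NormedSpace ℝ E] (Φ : E →L[ℝ] H01 Ω)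
    (m : Fin (N + 1) → Lp ℝ ∞ (volume.restrict Ω)) : Fin (N + 1) → E →L[ℝ] E →L[ℝ] ℝ :=
  fun i => (weightedForm (m i)).bilinearComp ((toFunL Ω).comp Φ) ((toFunL Ω).comp Φ) +
    if i = 0 then (gradForm Ω).bilinearComp Φ Φ else 0

theorem affine_galerkinForm_apply {E : Type*} [NormedAddCommGroup E] [NormedSpace ℝ E]
    (Φ : E →L[ℝ] H01 Ω) {μ : Fin (N + 1) → Space d → ℝ}
    (hμ : ∀ i, MemLp (μ i) ⊤ (volume.restrict Ω)) (t : Param N) (a b : E) :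
    affine (galerkinForm Φ fun i => (hμ i).toLp (μ i)) t a b =
      inner ℝ (grad (Φ a)) (grad (Φ b)) +
        ∫ x in Ω, potential μ x t * toFun (Φ a) x * toFun (Φ b) x := by
  rw [← affine_integral_mul_mul hμ]
  simp [affine, galerkinForm, Fin.succ_ne_zero, gradForm_apply]
  ring

/-- The gradient term is independent of t, so the Leibniz terms contain only L² forms, controlled by
the L^∞ norms of the μᵢ. -/
theorem galerkinForm_succ_apply {E : Type*} [NormedAddCommGroup E] [NormedSpace ℝ E]
    (Φ : E →L[ℝ] H01 Ω) (m : Fin (N + 1) → Lp ℝ ∞ (volume.restrict Ω)) (i : Fin N) (a b : E) :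
    galerkinForm Φ m i.succ a b = weightedForm (m i.succ) (toFun (Φ a)) (toFun (Φ b)) := by
  simp [galerkinForm, Fin.succ_ne_zero]

/-- Definiteness gives injectivity, and a finite-dimensional space and its dual have equal
dimension. -/
theorem exists_equiv_of_injective {E : Type*} [NormedAddCommGroup E] [NormedSpace ℝ E]
    [FiniteDimensional ℝ E] (A : E →L[ℝ] E →L[ℝ] ℝ) (hA : ∀ a, A a a = 0 → a = 0) :
    ∃ e : E ≃L[ℝ] (E →L[ℝ] ℝ), (e : E →L[ℝ] E →L[ℝ] ℝ) = A := by
  have hinj : Function.Injective (A : E →ₗ[ℝ] E →L[ℝ] ℝ) :=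
    (injective_iff_map_eq_zero _).2 fun a ha => hA a (by
      have : A a = 0 := ha
      rw [this]; rfl)
  have hdim : Module.finrank ℝ E = Module.finrank ℝ (E →L[ℝ] ℝ) := by
    rw [← (LinearMap.toContinuousLinearMap (𝕜 := ℝ) (E := E) (F' := ℝ)).finrank_eq]
    exact Subspace.dual_finrank_eq.symm
  refine ⟨(LinearEquiv.ofInjectiveOfFinrankEq _ hinj hdim).toContinuousLinearEquiv, ?_⟩
  ext a b
  rfl

end Forms

/-! ### Energy estimates for the parameter derivatives -/

section Energy

variable {d N : ℕ} {Ω : Set (Space d)}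

theorem contDiff_source (f : Fin (N + 1) → HNegOne Ω) : ContDiff ℝ ∞ (source f) :=
  contDiff_affine (X := HNegOne Ω) f

theorem wDualNorm_zero : wDualNorm (fun _ : Param N => (0 : HNegOne Ω)) = 0 := by
  simp [wDualNorm, wPairing]

/-- `‖f‖_{W'} + ∑ᵢ ‖∂_{t_i} f‖_{W'}`. -/
def sourceNorm (f : Fin (N + 1) → HNegOne Ω) : ℝ :=
  wDualNorm (source f) + ∑ i : Fin N, wDualNorm (partialDeriv i (source f))

theorem wDualNorm_partialDeriv_source_nonneg {c : ℝ} (hc0 : 0 ≤ c)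
    (hc : ∀ v : H01 Ω, ‖toFun v‖ ≤ c * ‖grad v‖) (f : Fin (N + 1) → HNegOne Ω) (i : Fin N) :
    0 ≤ wDualNorm (partialDeriv i (source f)) :=
  wDualNorm_nonneg hc0 hc (contDiff_partialDeriv (X := HNegOne Ω) (contDiff_source f) i).continuous

theorem sourceNorm_nonneg {c : ℝ} (hc0 : 0 ≤ c)
    (hc : ∀ v : H01 Ω, ‖toFun v‖ ≤ c * ‖grad v‖) (f : Fin (N + 1) → HNegOne Ω) :
    0 ≤ sourceNorm f :=
  add_nonneg (wDualNorm_nonneg hc0 hc (contDiff_source f).continuous)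
    (Finset.sum_nonneg fun i _ => wDualNorm_partialDeriv_source_nonneg hc0 hc f i)

/-- Derivatives of the affine source of order two and more vanish, so f and its first derivatives
suffice for every k. -/
theorem wDualNorm_wordDeriv_source_le {c : ℝ} (hc0 : 0 ≤ c)
    (hc : ∀ v : H01 Ω, ‖toFun v‖ ≤ c * ‖grad v‖) (f : Fin (N + 1) → HNegOne Ω)
    (L : List (Fin N)) : wDualNorm (wordDeriv L (source f)) ≤ sourceNorm f := by
  have h0 := wDualNorm_nonneg hc0 hc (contDiff_source f).continuous
  have h1 := wDualNorm_partialDeriv_source_nonneg hc0 hc f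
  have hcases : wordDeriv L (source f) = source f ∨
      (∃ i, wordDeriv L (source f) = partialDeriv i (source f)) ∨
      wordDeriv L (source f) = fun _ => 0 := wordDeriv_affine (X := HNegOne Ω) L f
  rcases hcases with h | ⟨i, h⟩ | h
  · rw [h]
    exact le_add_of_nonneg_right (Finset.sum_nonneg fun i _ => h1 i)
  · rw [h]
    exact (Finset.single_le_sum (f := fun i => wDualNorm (partialDeriv i (source f)))
      (fun i _ => h1 i) (Finset.mem_univ i)).trans (le_add_of_nonneg_left h0)
  · rw [h, wDualNorm_zero]
    exact sourceNorm_nonneg hc0 hc f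

/-- The constants in the energy estimates for the derivatives of order `n`. -/
def energyConst (q : ℝ) : ℕ → ℝ
  | 0 => 1
  | n + 1 => 1 + (n + 1) * (q * energyConst q n)

variable {E : Type*} [NormedAddCommGroup E] [NormedSpace ℝ E] {Φ : E →L[ℝ] H01 Ω}
  {m : Fin (N + 1) → Lp ℝ ∞ (volume.restrict Ω)} {f : Fin (N + 1) → HNegOne Ω}
  {x : Param N → E} {G : Set (Param N)}

theorem galerkinForm_wordDeriv_apply (hx : ContDiff ℝ ∞ x) (hG : IsOpen G)
    (heq : ∀ t ∈ G, affine (galerkinForm Φ m) t (x t) = (source f t).comp Φ)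
    (L : List (Fin N)) {t : Param N} (ht : t ∈ G) (b : E) :
    affine (galerkinForm Φ m) t (wordDeriv L x t) b = wordDeriv L (source f) t (Φ b) -
      ∑ j : Fin L.length, weightedForm (m (L.get j).succ)
        (toFun (Φ (wordDeriv (L.eraseIdx j) x t))) (toFun (Φ b)) := by
  -- T pulls functionals back to E. It is linear and continuous, so it commutes with parameter
  -- derivatives.
  let T : HNegOne Ω →L[ℝ] E →L[ℝ] ℝ := ContinuousLinearMap.precomp ℝ Φ
  have hT : ContDiff ℝ ∞ fun t => T (source f t) :=
    contDiff_clm_comp (X := HNegOne Ω) T (contDiff_source f)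
  have h := affine_apply_wordDeriv (galerkinForm Φ m) hx hT hG heq L t ht
  rw [wordDeriv_clm_comp (X := HNegOne Ω) T (contDiff_source f)] at h
  rw [h]
  simp only [sub_apply, sum_apply, galerkinForm_succ_apply]
  rfl

theorem continuous_comp_wordDeriv (hx : ContDiff ℝ ∞ x) (L : List (Fin N)) :
    Continuous fun t => Φ (wordDeriv L x t) :=
  Φ.continuous.comp (contDiff_wordDeriv hx L).continuous

/-- Test the differentiated equation with the derivative itself and integrate over the cube; one
factor of its energy norm then cancels. -/
theorem energyNorm_wordDeriv_le_sum {c M : ℝ} (hc0 : 0 ≤ c)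
    (hc : ∀ v : H01 Ω, ‖toFun v‖ ≤ c * ‖grad v‖) (hM : ∀ i, ‖m i‖ ≤ M)
    (hx : ContDiff ℝ ∞ x) (hG : IsOpen G) (hGc : paramCube N ⊆ G)
    (heq : ∀ t ∈ G, affine (galerkinForm Φ m) t (x t) = (source f t).comp Φ)
    (hco : ∀ t ∈ paramCube N, ∀ a, ‖grad (Φ a)‖ ^ 2 ≤ affine (galerkinForm Φ m) t a a)
    (L : List (Fin N)) :
    energyNorm (fun t => Φ (wordDeriv L x t)) ≤ sourceNorm f +
      ∑ j : Fin L.length, M * c ^ 2 * energyNorm (fun t => Φ (wordDeriv (L.eraseIdx j) x t)) := by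
  have hM0 : 0 ≤ M := (norm_nonneg _).trans (hM 0)
  obtain ⟨y, hy⟩ : ∃ y : List (Fin N) → Param N → H01 Ω,
      y = fun L t => Φ (wordDeriv L x t) := ⟨_, rfl⟩
  have hyc : ∀ L, Continuous (y L) := fun L => hy ▸ continuous_comp_wordDeriv hx L
  have hgc : ∀ L, Continuous fun t => ‖grad (y L t)‖ := fun L =>
    ((gradL Ω).continuous.comp (hyc L)).norm
  have hFc : Continuous (wordDeriv L (source f)) :=
    (contDiff_wordDeriv (X := HNegOne Ω) (contDiff_source f) L).continuous
  have hFy : Continuous fun t => wordDeriv L (source f) t (y L t) := hFc.clm_apply (hyc L)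
  have hpt : ∀ t ∈ paramCube N, ‖grad (y L t)‖ ^ 2 ≤ wordDeriv L (source f) t (y L t) +
      ∑ j : Fin L.length, M * c ^ 2 * (‖grad (y (L.eraseIdx j) t)‖ * ‖grad (y L t)‖) := by
    intro t ht
    have h1 := hco t ht (wordDeriv L x t)
    rw [galerkinForm_wordDeriv_apply hx hG heq L (hGc ht)] at h1
    subst hy
    refine h1.trans ?_
    rw [sub_eq_add_neg, ← Finset.sum_neg_distrib]
    gcongr with j
    refine (neg_le_abs _).trans ((abs_weightedForm_le _ _ _).trans ?_)
    -- M bounds the weight, and Poincaré is used once for each factor, whence M c².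
    calc _ ≤ M * (c * ‖grad (Φ (wordDeriv (L.eraseIdx j) x t))‖) *
          (c * ‖grad (Φ (wordDeriv L x t))‖) := by
          gcongr
          exacts [hM _, hc _, hc _]
      _ = _ := by ring
  have hint : energyNorm (y L) ^ 2 ≤ (sourceNorm f +
      ∑ j : Fin L.length, M * c ^ 2 * energyNorm (y (L.eraseIdx j))) * energyNorm (y L) := by
    rw [energyNorm_sq]
    have hi1 : ∀ j : Fin L.length, IntegrableOn (fun t => M * c ^ 2 *
        (‖grad (y (L.eraseIdx j) t)‖ * ‖grad (y L t)‖)) (paramCube N) := fun j =>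
      integrableOn_paramCube (continuous_const.mul ((hgc _).mul (hgc _)))
    have h1 := setIntegral_mono_on (integrableOn_paramCube ((hgc L).pow 2))
      ((integrableOn_paramCube hFy).add (integrable_finsetSum _ fun j _ => hi1 j))
      (measurableSet_paramCube N) hpt
    refine h1.trans ?_
    simp only [Pi.add_apply]
    rw [integral_add (integrableOn_paramCube hFy) (integrable_finsetSum _ fun j _ => hi1 j),
      integral_finsetSum _ fun j _ => hi1 j, add_mul, Finset.sum_mul]
    refine add_le_add ?_ (Finset.sum_le_sum fun j _ => ?_)
    · refine (integral_le_wDualNorm_mul hc0 hc hFc (hyc L)).trans ?_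
      exact mul_le_mul_of_nonneg_right (wDualNorm_wordDeriv_source_le hc0 hc f L)
        (energyNorm_nonneg _)
    · rw [integral_const_mul, mul_assoc (M * c ^ 2)]
      exact mul_le_mul_of_nonneg_left (integral_mul_le_sqrt_mul_sqrt
        (memLp_paramCube (hgc _)) (memLp_paramCube (hgc _))) (by positivity)
  have hR : 0 ≤ sourceNorm f +
      ∑ j : Fin L.length, M * c ^ 2 * energyNorm (y (L.eraseIdx j)) :=
    add_nonneg (sourceNorm_nonneg hc0 hc f)
      (Finset.sum_nonneg fun j _ => mul_nonneg (by positivity) (energyNorm_nonneg _))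
  have hfin : energyNorm (y L) ≤ sourceNorm f +
      ∑ j : Fin L.length, M * c ^ 2 * energyNorm (y (L.eraseIdx j)) := by
    -- From e² ≤ R e with R ≥ 0 one gets e ≤ R without dividing: e > R would force e² > R e.
    by_contra hlt
    push Not at hlt
    nlinarith [energyNorm_nonneg (y L)]
  rw [hy] at hfin
  exact hfin

/-- Induction runs on the length, not on the word, because the erased words are not tails. A word of
length n + 1 has n + 1 erasures, the factor in `energyConst`. -/
theorem energyNorm_wordDeriv_le {c M : ℝ} (hc0 : 0 ≤ c)
    (hc : ∀ v : H01 Ω, ‖toFun v‖ ≤ c * ‖grad v‖) (hM : ∀ i, ‖m i‖ ≤ M)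
    (hx : ContDiff ℝ ∞ x) (hG : IsOpen G) (hGc : paramCube N ⊆ G)
    (heq : ∀ t ∈ G, affine (galerkinForm Φ m) t (x t) = (source f t).comp Φ)
    (hco : ∀ t ∈ paramCube N, ∀ a, ‖grad (Φ a)‖ ^ 2 ≤ affine (galerkinForm Φ m) t a a)
    (n : ℕ) : ∀ L : List (Fin N), L.length = n →
      energyNorm (fun t => Φ (wordDeriv L x t)) ≤ energyConst (M * c ^ 2) n * sourceNorm f := by
  have hM0 : 0 ≤ M := (norm_nonneg _).trans (hM 0)
  induction n with
  | zero =>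
    intro L hL
    obtain rfl := List.eq_nil_of_length_eq_zero hL
    simpa [energyConst] using energyNorm_wordDeriv_le_sum hc0 hc hM hx hG hGc heq hco []
  | succ n ih =>
    intro L hL
    refine (energyNorm_wordDeriv_le_sum hc0 hc hM hx hG hGc heq hco L).trans ?_
    have hj : ∀ j : Fin L.length, M * c ^ 2 *
        energyNorm (fun t => Φ (wordDeriv (L.eraseIdx j) x t)) ≤
        M * c ^ 2 * (energyConst (M * c ^ 2) n * sourceNorm f) := fun j => by
      refine mul_le_mul_of_nonneg_left (ih _ ?_) (by positivity)
      rw [List.length_eraseIdx_of_lt j.2, hL]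
      rfl
    refine (add_le_add_right (Finset.sum_le_sum fun j _ => hj j) _).trans (le_of_eq ?_)
    rw [Finset.sum_const, Finset.card_univ, Fintype.card_fin, hL, nsmul_eq_mul]
    simp only [energyConst]
    push_cast
    ring

end Energy

/-! ### The Galerkin equation in coordinates -/

section Coordinates

variable {d N K : ℕ} {Ω : Set (Space d)} {V : Submodule ℝ (H01 Ω)} (φ : Module.Basis (Fin K) ℝ V)

/-- The map `a ↦ ∑ⱼ aⱼ φⱼ` from coefficient vectors to `H₀¹(Ω)`. -/
def synthesis : EuclideanSpace ℝ (Fin K) →L[ℝ] H01 Ω :=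
  LinearMap.toContinuousLinearMap
    (V.subtype ∘ₗ φ.equivFun.symm.toLinearMap ∘ₗ (WithLp.linearEquiv 2 ℝ (Fin K → ℝ)).toLinearMap)

theorem synthesis_apply (a : EuclideanSpace ℝ (Fin K)) :
    synthesis φ a = ((∑ j, a j • φ j : V) : H01 Ω) :=
  congrArg Subtype.val (φ.equivFun_symm_apply a)

theorem coeffs_sum (a : EuclideanSpace ℝ (Fin K)) : coeffs φ (∑ j, a j • φ j) = a := by
  have h : φ.equivFun (∑ j, a j • φ j) = WithLp.ofLp a := by
    rw [← φ.equivFun_symm_apply (WithLp.ofLp a), LinearEquiv.apply_symm_apply]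
  rw [coeffs, h]

theorem exists_synthesis_eq (v : V) : ∃ b, synthesis φ b = v :=
  ⟨coeffs φ v, by
    rw [synthesis_apply]
    exact congrArg Subtype.val (φ.sum_equivFun v)⟩

theorem affine_galerkinForm_apply_synthesis {μ : Fin (N + 1) → Space d → ℝ}
    (hμ : ∀ i, MemLp (μ i) ⊤ (volume.restrict Ω)) (t : Param N) (a : EuclideanSpace ℝ (Fin K))
    {b : EuclideanSpace ℝ (Fin K)} {v : V} (hb : synthesis φ b = v) :
    affine (galerkinForm (synthesis φ) fun i => (hμ i).toLp (μ i)) t a b =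
      inner ℝ (grad (∑ j, a j • φ j : V).1) (grad v.1) +
        ∫ x in Ω, potential μ x t * toFun (∑ j, a j • φ j : V).1 x * toFun v.1 x := by
  have h : ∀ {u v : H01 Ω}, synthesis φ a = u → synthesis φ b = v →
      affine (galerkinForm (synthesis φ) fun i => (hμ i).toLp (μ i)) t a b =
        inner ℝ (grad u) (grad v) + ∫ x in Ω, potential μ x t * toFun u x * toFun v x := by
    rintro _ _ rfl rfl
    exact affine_galerkinForm_apply (synthesis φ) hμ t a b
  exact h (synthesis_apply φ a) hb

theorem isGalerkinSolution_iff {μ : Fin (N + 1) → Space d → ℝ}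
    (hμ : ∀ i, MemLp (μ i) ⊤ (volume.restrict Ω)) (f : Fin (N + 1) → HNegOne Ω) (t : Param N)
    (a : EuclideanSpace ℝ (Fin K)) :
    IsGalerkinSolution μ f V t (∑ j, a j • φ j) ↔
      affine (galerkinForm (synthesis φ) fun i => (hμ i).toLp (μ i)) t a =
        (source f t).comp (synthesis φ) := by
  constructor
  · intro h
    ext b
    have hb := synthesis_apply φ b
    exact (affine_galerkinForm_apply_synthesis φ hμ t a hb).trans
      ((h _).trans (congrArg (source f t) hb.symm))
  · intro h v
    obtain ⟨b, hb⟩ := exists_synthesis_eq φ v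
    exact (affine_galerkinForm_apply_synthesis φ hμ t a hb).symm.trans
      ((DFunLike.congr_fun h b).trans (congrArg (source f t) hb))

theorem norm_grad_sq_le_galerkinForm {E : Type*} [NormedAddCommGroup E] [NormedSpace ℝ E]
    (Φ : E →L[ℝ] H01 Ω) {μ : Fin (N + 1) → Space d → ℝ}
    (hμ : ∀ i, MemLp (μ i) ⊤ (volume.restrict Ω))
    (hpos : ∀ᵐ p ∂(volume.restrict Ω).prod (volume.restrict (paramCube N)),
      0 ≤ potential μ p.1 p.2) :
    ∀ t ∈ paramCube N, ∀ a,
      ‖grad (Φ a)‖ ^ 2 ≤ affine (galerkinForm Φ fun i => (hμ i).toLp (μ i)) t a a := by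
  intro t ht a
  rw [affine_galerkinForm_apply, real_inner_self_eq_norm_sq]
  exact le_add_of_nonneg_right (potential_integral_nonneg hμ hpos _ t ht)

/-- Pointwise in t, bound the coefficients by the L² norm of the function and that by its gradient.
This is where the factor h^(−d/2), contained in e, enters the estimates. -/
theorem l2Norm_le_energyNorm {c e : ℝ} (hc : ∀ v : H01 Ω, ‖toFun v‖ ≤ c * ‖grad v‖) (he0 : 0 ≤ e)
    (he : ∀ v : V, ‖coeffs φ v‖ ≤ e * ‖toFun v.1‖) {w : Param N → EuclideanSpace ℝ (Fin K)}
    (hc0 : 0 ≤ c) (hw : Continuous w) :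
    l2Norm w ≤ e * c * energyNorm (fun t => synthesis φ (w t)) := by
  have hw2 : MemLp w 2 (volume.restrict (paramCube N)) := memLp_paramCube hw
  have h1 : l2Norm w ^ 2 = ∫ t in paramCube N, ‖w t‖ ^ 2 := by
    rw [l2Norm, ← Lp.norm_toLp w hw2, norm_sq_eq_integral]
    exact integral_congr_ae (hw2.coeFn_toLp.mono fun t ht => by simp only [ht])
  have hgc : Continuous fun t => ‖grad (synthesis φ (w t))‖ :=
    ((gradL Ω).continuous.comp ((synthesis φ).continuous.comp hw)).norm
  refine (pow_le_pow_iff_left₀ ENNReal.toReal_nonneg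
    (mul_nonneg (by positivity) (energyNorm_nonneg _)) two_ne_zero).1 ?_
  change l2Norm w ^ 2 ≤ _
  rw [h1, mul_pow, energyNorm_sq, ← integral_const_mul]
  refine setIntegral_mono_on (integrableOn_paramCube (by fun_prop))
    (integrableOn_paramCube (by fun_prop)) (measurableSet_paramCube N) fun t _ => ?_
  rw [← mul_pow]
  gcongr
  have h := he (∑ j, w t j • φ j)
  rw [coeffs_sum, ← synthesis_apply] at h
  refine h.trans ?_
  rw [mul_assoc]
  exact mul_le_mul_of_nonneg_left (hc _) he0

/-- Zero energy forces a zero gradient, then a zero function by Poincaré, then zero coefficients by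
the bound on E. -/
theorem exists_equiv_galerkinForm {c e : ℝ} (hc : ∀ v : H01 Ω, ‖toFun v‖ ≤ c * ‖grad v‖)
    (he : ∀ v : V, ‖coeffs φ v‖ ≤ e * ‖toFun v.1‖) {m : Fin (N + 1) → Lp ℝ ∞ (volume.restrict Ω)}
    {t : Param N}
    (hco : ∀ a, ‖grad (synthesis φ a)‖ ^ 2 ≤ affine (galerkinForm (synthesis φ) m) t a a) :
    ∃ e : EuclideanSpace ℝ (Fin K) ≃L[ℝ] (EuclideanSpace ℝ (Fin K) →L[ℝ] ℝ),
      (e : EuclideanSpace ℝ (Fin K) →L[ℝ] EuclideanSpace ℝ (Fin K) →L[ℝ] ℝ) =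
        affine (galerkinForm (synthesis φ) m) t := by
  refine exists_equiv_of_injective _ fun a ha => ?_
  have h1 := hco a
  rw [ha] at h1
  have h2 : ‖grad (synthesis φ a)‖ = 0 :=
    (pow_eq_zero_iff two_ne_zero).1 (le_antisymm h1 (sq_nonneg _))
  have h3 := he (∑ j, a j • φ j)
  rw [coeffs_sum, ← synthesis_apply] at h3
  have h4 := hc (synthesis φ a)
  rw [h2, mul_zero] at h4
  rw [le_antisymm h4 (norm_nonneg _), mul_zero] at h3
  exact norm_le_zero_iff.1 h3

/-- The Galerkin solution extends to a smooth function of the parameter, whose derivatives satisfy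
the energy estimates. -/
theorem exists_smooth_galerkin_solution {c e M : ℝ} (hc0 : 0 ≤ c)
    (hc : ∀ v : H01 Ω, ‖toFun v‖ ≤ c * ‖grad v‖)
    (he : ∀ v : V, ‖coeffs φ v‖ ≤ e * ‖toFun v.1‖) {μ : Fin (N + 1) → Space d → ℝ}
    (hμ : ∀ i, MemLp (μ i) ⊤ (volume.restrict Ω)) (hM : ∀ i, ‖(hμ i).toLp (μ i)‖ ≤ M)
    (hpos : ∀ᵐ p ∂(volume.restrict Ω).prod (volume.restrict (paramCube N)),
      0 ≤ potential μ p.1 p.2) (f : Fin (N + 1) → HNegOne Ω) :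
    ∃ x : Param N → EuclideanSpace ℝ (Fin K), ContDiff ℝ ∞ x ∧
      (∀ t ∈ paramCube N, ∀ a : EuclideanSpace ℝ (Fin K),
        IsGalerkinSolution μ f V t (∑ j, a j • φ j) ↔ a = x t) ∧
      ∀ L : List (Fin N), energyNorm (fun t => synthesis φ (wordDeriv L x t)) ≤
        energyConst (M * c ^ 2) L.length * sourceNorm f := by
  have hco := norm_grad_sq_le_galerkinForm (synthesis φ) hμ hpos
  have hinv := fun t ht => exists_equiv_galerkinForm φ hc he (hco t ht)
  obtain ⟨x, hx, G, hGo, hGc, hxG⟩ := exists_contDiff_solution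
    (galerkinForm (synthesis φ) fun i => (hμ i).toLp (μ i))
    (fun i => (f i).comp (synthesis φ)) hinv
  have hsrc : ∀ t, affine (fun i => (f i).comp (synthesis φ)) t =
      (source f t).comp (synthesis φ) := fun t =>
    (clm_affine (X := HNegOne Ω) (ContinuousLinearMap.precomp ℝ (synthesis φ)) f t).symm
  simp only [hsrc] at hxG
  refine ⟨x, hx, fun t ht a => ?_, fun L =>
    energyNorm_wordDeriv_le hc0 hc hM hx hGo hGc hxG hco L.length L rfl⟩
  rw [isGalerkinSolution_iff φ hμ, ← hxG t (hGc ht)]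
  obtain ⟨e, he⟩ := hinv t ht
  rw [← he]
  exact e.injective.eq_iff

/-- The estimate of the weak derivative `∂_t^α` of the coefficients of the Galerkin solution. -/
theorem l2Norm_weakDeriv_le {c e q : ℝ} (hc0 : 0 ≤ c)
    (hc : ∀ v : H01 Ω, ‖toFun v‖ ≤ c * ‖grad v‖) (he0 : 0 ≤ e)
    (he : ∀ v : V, ‖coeffs φ v‖ ≤ e * ‖toFun v.1‖) {f : Fin (N + 1) → HNegOne Ω}
    {x u w : Param N → EuclideanSpace ℝ (Fin K)} (hx : ContDiff ℝ ∞ x)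
    (hux : u =ᵐ[volume.restrict (paramCube N)] x)
    (hen : ∀ L : List (Fin N), energyNorm (fun t => synthesis φ (wordDeriv L x t)) ≤
      energyConst q L.length * sourceNorm f) {α : Fin N → ℕ} (hw : HasWeakDeriv α u w) :
    l2Norm w ≤ e * c * (energyConst q (∑ i, α i) * sourceNorm f) := by
  have hl : l2Norm w = l2Norm (wordDeriv (multiWord α).reverse x) :=
    congrArg ENNReal.toReal (eLpNorm_congr_ae (hw.ae_eq (hasWeakDeriv_of_contDiff hx hux α)))
  have h := hen (multiWord α).reverse
  rw [List.length_reverse, length_multiWord] at h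
  rw [hl]
  exact (l2Norm_le_energyNorm φ hc he0 he hc0 (contDiff_wordDeriv hx _).continuous).trans
    (mul_le_mul_of_nonneg_left h (by positivity))

end Coordinates

end ParamFEM
end

theorem mainTheorem9 {d N : ℕ} (hd : 0 < d)
    (Ω : Set (ParamFEM.Space d)) (hΩ_open : IsOpen Ω) (hΩ_bdd : Bornology.IsBounded Ω)
    (μmin μmax : ℝ) (hμmin : 0 < μmin) (hμmax : μmin ≤ μmax)
    (M : Fin (N + 1) → ℝ≥0) (cE : ℝ) (k : ℕ) (hk : 1 ≤ k) :
    ∃ C : ℝ,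
      ∀ (μ : Fin (N + 1) → ParamFEM.Space d → ℝ) (f : Fin (N + 1) → ParamFEM.HNegOne Ω)
        (h : ℝ) (K : ℕ) (V : Submodule ℝ (ParamFEM.H01 Ω)) (φ : Module.Basis (Fin K) ℝ V),
        (∀ i, MemLp (μ i) ⊤ (volume.restrict Ω)) →
        (∀ i, eLpNorm (μ i) ⊤ (volume.restrict Ω) ≤ (M i : ℝ≥0∞)) →
        (∀ᵐ p ∂(volume.restrict Ω).prod (volume.restrict (ParamFEM.paramCube N)),
          μmin ≤ ParamFEM.potential μ p.1 p.2 ∧ ParamFEM.potential μ p.1 p.2 ≤ μmax) →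
        0 < h →
        (∀ v : V, ‖ParamFEM.coeffs φ v‖ ≤ cE * h ^ (-(d : ℝ) / 2) * ‖ParamFEM.toFun v.1‖) →
        (∀ t ∈ ParamFEM.paramCube N,
          ∃! a : EuclideanSpace ℝ (Fin K),
            ParamFEM.IsGalerkinSolution μ f V t (∑ j, a j • φ j)) ∧
        ∀ u : ParamFEM.Param N → EuclideanSpace ℝ (Fin K),
          (∀ᵐ t ∂volume.restrict (ParamFEM.paramCube N),
            ParamFEM.IsGalerkinSolution μ f V t (∑ j, u t j • φ j)) →
          ParamFEM.MemHk k u ∧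
          (∀ w : (Fin N → ℕ) → ParamFEM.Param N → EuclideanSpace ℝ (Fin K),
            (∀ α ∈ ParamFEM.multiIndices N k, ParamFEM.HasWeakDeriv α u (w α)) →
            ∑ α ∈ ParamFEM.multiIndices N k, ParamFEM.l2Norm (w α) ≤
              C * h ^ (-(d : ℝ) / 2) *
                (ParamFEM.wDualNorm (ParamFEM.source f) +
                  ∑ i : Fin N,
                    ParamFEM.wDualNorm (ParamFEM.partialDeriv i (ParamFEM.source f)))) ∧
          ∀ j : Fin K, ParamFEM.MemHk k (fun t => u t j) := by
  obtain ⟨c, hc0, hc⟩ := ParamFEM.exists_poincare hd hΩ_bdd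
  -- The sum of the bounds for the single derivatives. The sum of the Mᵢ bounds all weights at once,
  -- and |cE| appears because the sign of cE is not prescribed.
  refine ⟨∑ α ∈ ParamFEM.multiIndices N k,
    |cE| * c * ParamFEM.energyConst ((∑ i, (M i : ℝ)) * c ^ 2) (∑ i, α i), ?_⟩
  intro μ f h K V φ hμ hμM hbd hh hE
  have hp : 0 ≤ h ^ (-(d : ℝ) / 2) := Real.rpow_nonneg hh.le _
  have hM : ∀ i, ‖(hμ i).toLp (μ i)‖ ≤ ∑ i, (M i : ℝ) := fun i => by
    refine le_trans ?_ (Finset.single_le_sum (f := fun i => (M i : ℝ))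
      (fun i _ => (M i).2) (Finset.mem_univ i))
    rw [Lp.norm_toLp]
    exact ENNReal.toReal_le_coe_of_le_coe (hμM i)
  have he0 : 0 ≤ |cE| * h ^ (-(d : ℝ) / 2) := mul_nonneg (abs_nonneg cE) hp
  have he : ∀ v : V, ‖ParamFEM.coeffs φ v‖ ≤
      |cE| * h ^ (-(d : ℝ) / 2) * ‖ParamFEM.toFun v.1‖ := fun v =>
    (hE v).trans (mul_le_mul_of_nonneg_right
      (mul_le_mul_of_nonneg_right (le_abs_self cE) hp) (norm_nonneg _))
  have hpos : ∀ᵐ p ∂(volume.restrict Ω).prod (volume.restrict (ParamFEM.paramCube N)),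
      0 ≤ ParamFEM.potential μ p.1 p.2 := hbd.mono fun p hp => hμmin.le.trans hp.1
  have hex := ParamFEM.exists_smooth_galerkin_solution φ hc0 hc he hμ hM hpos f
  obtain ⟨x, hx, hsol, hen⟩ := hex
  refine ⟨fun t ht => ⟨x t, (hsol t ht _).2 rfl, fun a ha => (hsol t ht a).1 ha⟩, fun u hu => ?_⟩
  have hux : u =ᵐ[volume.restrict (ParamFEM.paramCube N)] x := by
    filter_upwards [hu, ae_restrict_mem (ParamFEM.measurableSet_paramCube N)] with t ht hmem
    exact (hsol t hmem _).1 ht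
  refine ⟨ParamFEM.memHk_of_contDiff hx hux k, fun w hw => ?_, fun j => ?_⟩
  · rw [Finset.sum_mul, Finset.sum_mul]
    refine Finset.sum_le_sum fun α hα => ?_
    refine (ParamFEM.l2Norm_weakDeriv_le φ hc0 hc he0 he hx hux hen (hw α hα)).trans
      (le_of_eq ?_)
    simp only [ParamFEM.sourceNorm]
    ring
  · have hg : ContDiff ℝ ∞ fun t => x t j :=
      (EuclideanSpace.proj j : EuclideanSpace ℝ (Fin K) →L[ℝ] ℝ).contDiff.comp hx
    exact ParamFEM.memHk_of_contDiff hg (hux.mono fun t ht => by simp only [ht]) k
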